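/- Drawings are in the Euclidean plane: in a drawing of a finite simple graph the vertices are distinct points, every edge is a simple curve (Jordan arc) joining its two end vertices and containing no other vertex, and two distinct edges have only finitely many common interior points, at each of which they cross properly. A drawing is planar if no two edges cross, and quasiplanar if no three edges pairwise cross; a graph is planar if it has a planar drawing. Graphs $G_1,\dots,G_k$ with the same vertex set $V$ admit a QuaSEFE if they have quasiplanar drawings $\Gamma_1,\dots,\Gamma_k$, respectively, such that every vertex of $V$ has the same position in all $\Gamma_i$, and every edge shared by $G_i$ and $G_j$ is drawn as the same curve in $\Gamma_i$ and $\Gamma_j$. Let $G_1=(V,E_1)$ and $G_3=(V,E_3)$ be planar graphs and let $T_2=(V,E_2)$ be a tree on the same finite vertex set $V$. Then $\langle G_1,T_2,G_3\rangle$ admits a QuaSEFE in which the drawing of $G_3$ is planar. -/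

import Mathlib

namespace QuaSEFE

/-- The Euclidean plane. -/
abbrev Plane : Type := EuclideanSpace ℝ (Fin 2)

/-- `C` is (the point set of) a simple curve, that is a Jordan arc, with end points `a` and `b`. -/
def IsArc (C : Set Plane) (a b : Plane) : Prop :=
  ∃ γ : Path a b, Function.Injective γ ∧ Set.range γ = C

/-- The curves `C` and `D` cross properly at `p`: in suitable local coordinates around `p` they
are the two coordinate axes (so each passes through `p` from one side of the other to the other
side; they do not merely touch there). -/
def CrossProperlyAt (C D : Set Plane) (p : Plane) : Prop :=
  ∃ φ : OpenPartialHomeomorph Plane (ℝ × ℝ), p ∈ φ.source ∧ φ p = (0, 0) ∧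
    ∀ q ∈ φ.source, (q ∈ C ↔ (φ q).2 = 0) ∧ (q ∈ D ↔ (φ q).1 = 0)

/-- A drawing of a graph in the plane: vertices are distinct points, every edge is a Jordan arc
between its end vertices which contains no other vertex, and any two distinct edges have only
finitely many common interior points, at each of which they cross properly. Adjacent edges may
cross, and two edges may cross several times. -/
structure Drawing {V : Type*} (G : SimpleGraph V) where
  /-- the position of a vertex -/
  pos : V → Plane
  /-- the curve representing an edge, as a set of points -/
  curve : G.edgeSet → Set Plane
  pos_injective : Function.Injective pos
  isArc : ∀ (u v : V) (h : G.Adj u v), IsArc (curve ⟨s(u, v), h⟩) (pos u) (pos v)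
  mem_of_pos_mem : ∀ (e : G.edgeSet) (w : V), pos w ∈ curve e → w ∈ (e : Sym2 V)
  finite_inter : ∀ e f : G.edgeSet, e ≠ f →
    ((curve e \ Set.range pos) ∩ (curve f \ Set.range pos)).Finite
  crossProperly : ∀ e f : G.edgeSet, e ≠ f →
    ∀ p ∈ (curve e \ Set.range pos) ∩ (curve f \ Set.range pos),
      CrossProperlyAt (curve e) (curve f) p

namespace Drawing

variable {V : Type*} {G : SimpleGraph V}

/-- Two distinct edges cross in a drawing if their curves have a common interior point. (The
vertices lying on a curve are exactly its two end points.) -/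
def Cross (Γ : Drawing G) (e f : G.edgeSet) : Prop :=
  e ≠ f ∧ ((Γ.curve e \ Set.range Γ.pos) ∩ (Γ.curve f \ Set.range Γ.pos)).Nonempty

/-- A drawing is planar if no two edges cross. -/
def IsPlanar (Γ : Drawing G) : Prop :=
  ∀ e f : G.edgeSet, ¬ Γ.Cross e f

/-- A drawing is quasiplanar if no three edges pairwise cross. -/
def IsQuasiplanar (Γ : Drawing G) : Prop :=
  ∀ e f g : G.edgeSet, ¬ (Γ.Cross e f ∧ Γ.Cross f g ∧ Γ.Cross e g)

end Drawing

/-- A graph is planar if it has a planar drawing. -/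
def IsPlanarGraph {V : Type*} (G : SimpleGraph V) : Prop :=
  ∃ Γ : Drawing G, Γ.IsPlanar

/-- Drawings `Γ i` of graphs `G i` with the same vertex set are simultaneous with fixed edges:
every vertex has the same position in all of them, and an edge shared by two graphs is
represented by the same curve in both drawings. -/
def IsSimultaneous {V ι : Type*} {G : ι → SimpleGraph V} (Γ : ∀ i, Drawing (G i)) : Prop :=
  (∀ i j v, (Γ i).pos v = (Γ j).pos v) ∧
    ∀ i j (e : Sym2 V) (hi : e ∈ (G i).edgeSet) (hj : e ∈ (G j).edgeSet),
      (Γ i).curve ⟨e, hi⟩ = (Γ j).curve ⟨e, hj⟩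

/-- The drawings `Γ i` form a QuaSEFE of the family `G i`. -/
def IsQuaSEFE {V ι : Type*} {G : ι → SimpleGraph V} (Γ : ∀ i, Drawing (G i)) : Prop :=
  (∀ i, (Γ i).IsQuasiplanar) ∧ IsSimultaneous Γ

end QuaSEFE

namespace QuaSEFE

open Set Topology

/-! ### Lines and segments in the plane -/

/-! Give every edge of `G₃` one curve, used in all three drawings, and let A be the edge set of
`G₃`. If in each graph neither the edges in A nor those outside A cross among themselves, every
crossing pairs an edge of A with one outside A. Three pairwise crossing edges are then impossible by
pigeonhole. The drawing of `G₃` uses only A, so it is planar.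

It remains to draw `G₁` \ A and `T₂` \ A without internal crossings, on common vertex positions and
agreeing on shared edges. `G₁` is redrawn planarly on the given positions: a homeomorphism of the
plane moves its vertices there (`exists_homeomorph_apply_eq`), and each edge becomes a polygonal arc
in its own corridor (`exists_regions`). The edges of `T₂` in `G₁` but not in `G₃` keep these curves.
They form a forest, and a polygonal forest does not disconnect the plane
(`IsGenericSystem.isPreconnected_compl`). The remaining tree edges are therefore added one by one in
the complement (`IsGenericSystem.exists_insert`). New tree edges and edges only in `G₁` never share
a drawing, so their mutual position is irrelevant.

Proper crossings come from general position. `G₃` is drawn first, polygonally, and M collects its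
vertices and bends. Later arcs have no interior node on a line spanned by M, and none of their
segments lies in such a line. They therefore meet the arcs of `G₃` transversally and finitely often
away from the vertices (`PolyArc.crossProperlyAt`). Choosing bends off finitely many lines
(`exists_mem_not_mem_lines`) yields such arcs in any connected open set from which both ends are
accessible (`exists_isGenericArc`). -/

/-- The determinant of two plane vectors. -/
def cross (u v : Plane) : ℝ := u 0 * v 1 - u 1 * v 0

theorem plane_ext {u v : Plane} (h0 : u 0 = v 0) (h1 : u 1 = v 1) : u = v := by
  ext i; fin_cases i <;> assumption

theorem continuous_cross_sub (w p : Plane) : Continuous fun q : Plane => cross w (q - p) := by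
  unfold cross
  fun_prop

theorem cross_smul_self (w : Plane) (t : ℝ) : cross w (t • w) = 0 := by
  simp [cross]; ring

theorem exists_smul_of_cross_eq_zero {w v : Plane} (hw : w ≠ 0) (h : cross w v = 0) :
    ∃ t : ℝ, v = t • w := by
  unfold cross at h
  by_cases h0 : w 0 = 0
  · have h1 : w 1 ≠ 0 := fun h1 => hw (plane_ext (by simpa using h0) (by simpa using h1))
    refine ⟨v 1 / w 1, plane_ext ?_ ?_⟩
    · have : v 0 = 0 := by
        rw [h0] at h; simpa [h1] using h
      simp [h0, this]
    · simp; field_simp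
  · refine ⟨v 0 / w 0, plane_ext ?_ ?_⟩
    · simp; field_simp
    · simp; field_simp; linarith

/-- The line through `x` and `y`, which is a single point if `x = y`. -/
def line (x y : Plane) : Set Plane := {p | ∃ t : ℝ, p = x + t • (y - x)}

/-- The union of all lines spanned by two points of `M`, together with the points of `M`. -/
def spanLines (M : Set Plane) : Set Plane := {p | ∃ x ∈ M, ∃ y ∈ M, p ∈ line x y}

theorem subset_spanLines (M : Set Plane) : M ⊆ spanLines M :=
  fun x hx => ⟨x, hx, x, hx, 0, by simp⟩

theorem right_mem_line (x y : Plane) : y ∈ line x y := ⟨1, by simp⟩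

theorem left_mem_line (x y : Plane) : x ∈ line x y := ⟨0, by simp⟩

theorem mem_segment_iff_exists {x y p : Plane} :
    p ∈ segment ℝ x y ↔ ∃ t : ℝ, 0 ≤ t ∧ t ≤ 1 ∧ p = x + t • (y - x) := by
  rw [segment_eq_image']
  constructor
  · rintro ⟨t, ⟨h0, h1⟩, rfl⟩; exact ⟨t, h0, h1, rfl⟩
  · rintro ⟨t, h0, h1, rfl⟩; exact ⟨t, ⟨h0, h1⟩, rfl⟩

/-- This turns the wish that a segment from b miss a point m into a condition on its free end c: it
suffices to choose c off one line. -/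
theorem mem_line_of_mem_segment {b c m : Plane} (hm : m ∈ segment ℝ b c) (hne : m ≠ b) :
    c ∈ line b m := by
  obtain ⟨t, -, -, rfl⟩ := mem_segment_iff_exists.1 hm
  have ht : t ≠ 0 := by rintro rfl; simp at hne
  exact ⟨t⁻¹, by rw [add_sub_cancel_left, smul_smul, inv_mul_cancel₀ ht]; simp⟩

theorem segment_subset_line {x y : Plane} : segment ℝ x y ⊆ line x y := fun p hp => by
  obtain ⟨t, -, -, h⟩ := mem_segment_iff_exists.1 hp
  exact ⟨t, h⟩

theorem isClosed_segment (x y : Plane) : IsClosed (segment ℝ x y) := by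
  rw [segment_eq_image']
  exact (isCompact_Icc.image (by fun_prop)).isClosed

theorem cross_mem_line {x y p q : Plane} (hp : p ∈ line x y) (hq : q ∈ line x y) :
    cross (y - x) (q - p) = 0 := by
  obtain ⟨s, rfl⟩ := hp
  obtain ⟨t, rfl⟩ := hq
  have : x + t • (y - x) - (x + s • (y - x)) = (t - s) • (y - x) := by module
  rw [this, cross_smul_self]

theorem mem_line_of_cross {x y p q : Plane} (hxy : x ≠ y) (hp : p ∈ line x y)
    (h : cross (y - x) (q - p) = 0) : q ∈ line x y := by
  obtain ⟨s, rfl⟩ := hp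
  obtain ⟨t, ht⟩ := exists_smul_of_cross_eq_zero (sub_ne_zero.2 hxy.symm) h
  exact ⟨s + t, by rw [sub_eq_iff_eq_add.1 ht]; module⟩

theorem isClosed_line (x y : Plane) : IsClosed (line x y) := by
  by_cases h : x = y
  · have : line x y = {x} := by ext p; simp [line, h]
    rw [this]; exact isClosed_singleton
  · have : line x y = {q | cross (y - x) (q - x) = 0} := by
      ext q
      exact ⟨fun hq => cross_mem_line (left_mem_line x y) hq,
        fun hq => mem_line_of_cross h (left_mem_line x y) hq⟩
    rw [this]
    exact isClosed_eq (continuous_cross_sub _ _) continuous_const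

/-- Around an interior point of the line every direction would have zero determinant with y - x.
This forces x = y, and a single point is not open. -/
theorem dense_compl_line (x y : Plane) : Dense (line x y)ᶜ := by
  rw [← interior_eq_empty_iff_dense_compl, Set.eq_empty_iff_forall_notMem]
  intro p hp
  obtain ⟨ε, hε, hb⟩ := Metric.isOpen_iff.1 isOpen_interior p hp
  have key : ∀ v : Plane, cross (y - x) v = 0 := by
    intro v
    have hc : Filter.Tendsto (fun t : ℝ => p + t • v) (𝓝[≠] 0) (𝓝 p) := by
      have : Continuous (fun t : ℝ => p + t • v) := by fun_prop
      have := this.tendsto 0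
      simp only [zero_smul, add_zero] at this
      exact this.mono_left nhdsWithin_le_nhds
    have h1 : ∀ᶠ t in 𝓝[≠] (0 : ℝ), p + t • v ∈ Metric.ball p ε :=
      hc.eventually (Metric.ball_mem_nhds p hε)
    obtain ⟨t, ht, ht0⟩ := (h1.and self_mem_nhdsWithin).exists
    have h2 := cross_mem_line (interior_subset hp) (interior_subset (hb ht))
    have h3 : t * cross (y - x) v = 0 := by
      rw [← h2]; simp [cross]; ring
    exact (mul_eq_zero.1 h3).resolve_left ht0
  have hxy : x = y := by
    apply plane_ext
    · have := key !₂[0, 1]; simp [cross] at this; linarith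
    · have := key !₂[1, 0]; simp [cross] at this; linarith
  have hl : line x y = {x} := by ext p; simp [line, hxy]
  rw [hl] at hp
  have : IsOpen ({x} : Set Plane) := by
    have h2 : interior ({x} : Set Plane) = {x} := by
      apply (interior_subset).antisymm
      intro q hq
      have hpx : p = x := mem_singleton_iff.1 (interior_subset hp)
      have hqx : q = x := hq
      rw [hqx]; rwa [hpx] at hp
    rw [← h2]; exact isOpen_interior
  exact not_isOpen_singleton x this

/-- Every nonempty open set has a point outside finitely many lines. -/
theorem exists_mem_not_mem_lines {F : Set (Plane × Plane)} (hF : F.Finite) {W : Set Plane}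
    (hW : IsOpen W) (hne : W.Nonempty) : ∃ c ∈ W, ∀ z ∈ F, c ∉ line z.1 z.2 := by
  have key : Dense (⋂ z ∈ F, (line z.1 z.2)ᶜ) := by
    refine dense_biInter_of_isOpen (fun z _ => (isClosed_line _ _).isOpen_compl) hF.countable
      (fun z _ => dense_compl_line _ _)
  obtain ⟨c, hc, hcF⟩ := key.inter_open_nonempty W hW hne
  exact ⟨c, hc, fun z hz => by simpa using mem_iInter₂.1 hcF z hz⟩

/-- A segment with an end point outside a line meets the line at most once. -/
theorem subsingleton_segment_inter_line {x y a b : Plane} (h : x ∉ line a b ∨ y ∉ line a b) :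
    (segment ℝ x y ∩ line a b).Subsingleton := by
  rintro p ⟨hp, hpl⟩ q ⟨hq, hql⟩
  by_contra hpq
  obtain ⟨s, -, -, rfl⟩ := mem_segment_iff_exists.1 hp
  obtain ⟨t, -, -, rfl⟩ := mem_segment_iff_exists.1 hq
  have hst : t - s ≠ 0 := fun h => hpq (by rw [sub_eq_zero.1 h])
  by_cases hab : a = b
  · apply hpq
    obtain ⟨_, h1⟩ := hpl
    obtain ⟨_, h2⟩ := hql
    rw [h1, h2, hab]; simp
  have h1 := cross_mem_line hpl hql
  have h2 : cross (b - a) (y - x) = 0 := by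
    have : (t - s) * cross (b - a) (y - x) = 0 := by
      rw [← h1]; simp [cross]; ring
    exact (mul_eq_zero.1 this).resolve_left hst
  rcases h with h | h
  · apply h
    apply mem_line_of_cross hab hpl
    have : x - (x + s • (y - x)) = (-s) • (y - x) := by module
    rw [this]
    have : cross (b - a) (-s • (y - x)) = -s * cross (b - a) (y - x) := by simp [cross]; ring
    rw [this, h2, mul_zero]
  · apply h
    apply mem_line_of_cross hab hpl
    have : y - (x + s • (y - x)) = (1 - s) • (y - x) := by module
    rw [this]
    have : cross (b - a) ((1 - s) • (y - x)) = (1 - s) * cross (b - a) (y - x) := by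
      simp [cross]; ring
    rw [this, h2, mul_zero]

/-- Source of the finiteness of crossings: a segment with an end off all spanned lines lies in none
of them, so it meets each at most once. -/
theorem finite_segment_inter_spanLines {M : Set Plane} (hM : M.Finite) {x y : Plane}
    (h : x ∉ spanLines M ∨ y ∉ spanLines M) : (segment ℝ x y ∩ spanLines M).Finite := by
  have : segment ℝ x y ∩ spanLines M ⊆
      ⋃ z ∈ M ×ˢ M, (segment ℝ x y ∩ line z.1 z.2) := by
    rintro p ⟨hp, a, ha, b, hb, hl⟩
    exact mem_biUnion (show (a, b) ∈ M ×ˢ M from ⟨ha, hb⟩) ⟨hp, hl⟩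
  refine Finite.subset (Finite.biUnion (hM.prod hM) ?_) this
  rintro ⟨a, b⟩ ⟨ha, hb⟩
  exact (subsingleton_segment_inter_line (h.imp (fun h h' => h ⟨a, ha, b, hb, h'⟩)
    (fun h h' => h ⟨a, ha, b, hb, h'⟩))).finite

/-! ### Sets that are locally a line, and proper crossings -/

/-- Near `p` the set `C` is the line through `p` with direction `w`. -/
def LocallyLineAt (C : Set Plane) (p w : Plane) : Prop :=
  ∃ ε > 0, ∀ q ∈ Metric.ball p ε, q ∈ C ↔ cross w (q - p) = 0

/-- The affine coordinates with origin `p` and axes in the directions `v` and `w`. -/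
noncomputable def axesHomeomorph (p v w : Plane) (h : cross v w ≠ 0) : Plane ≃ₜ ℝ × ℝ where
  toFun q := (cross v (q - p), cross w (q - p))
  invFun z := p + (-(z.2 / cross v w)) • v + (z.1 / cross v w) • w
  left_inv q := by
    obtain ⟨d, hd⟩ : ∃ d, d = cross v w := ⟨_, rfl⟩
    rw [← hd] at h ⊢
    unfold cross at hd
    apply plane_ext <;> simp [cross] <;> field_simp <;> rw [hd] <;> ring
  right_inv z := by
    obtain ⟨d, hd⟩ : ∃ d, d = cross v w := ⟨_, rfl⟩
    rw [← hd] at h ⊢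
    unfold cross at hd
    apply Prod.ext <;> simp [cross] <;> field_simp <;> rw [hd] <;> ring
  continuous_toFun := (continuous_cross_sub v p).prodMk (continuous_cross_sub w p)
  continuous_invFun := by fun_prop

/-- Two independent directions give affine coordinates at p whose axes are the two local lines. -/
theorem crossProperlyAt_of_locallyLineAt {C D : Set Plane} {p w v : Plane}
    (hC : LocallyLineAt C p w) (hD : LocallyLineAt D p v) (h : cross v w ≠ 0) :
    CrossProperlyAt C D p := by
  obtain ⟨ε, hε, hC⟩ := hC
  obtain ⟨δ, hδ, hD⟩ := hD
  refine ⟨(axesHomeomorph p v w h).toOpenPartialHomeomorph.restrOpen (Metric.ball p (min ε δ))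
    Metric.isOpen_ball, ?_, ?_, ?_⟩
  · simp [hε, hδ]
  · simp [axesHomeomorph, cross]
  · intro q hq
    have hq' : dist q p < ε ∧ dist q p < δ := by simpa using hq
    exact ⟨hC q hq'.1, hD q hq'.2⟩

theorem LocallyLineAt.union {C D : Set Plane} {p w : Plane} (h : LocallyLineAt C p w)
    (hD : IsClosed D) (hp : p ∉ D) : LocallyLineAt (C ∪ D) p w := by
  obtain ⟨ε, hε, h⟩ := h
  obtain ⟨δ, hδ, hb⟩ := Metric.isOpen_iff.1 hD.isOpen_compl p hp
  refine ⟨min ε δ, lt_min hε hδ, fun q hq => ?_⟩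
  have h1 := h q (Metric.ball_subset_ball (min_le_left _ _) hq)
  have h2 : q ∉ D := hb (Metric.ball_subset_ball (min_le_right _ _) hq)
  rw [mem_union, h1]; simp [h2]

theorem locallyLineAt_segment {x y p : Plane} (hp : p ∈ segment ℝ x y) (hx : p ≠ x)
    (hy : p ≠ y) : LocallyLineAt (segment ℝ x y) p (y - x) := by
  obtain ⟨s, hs0, hs1, rfl⟩ := mem_segment_iff_exists.1 hp
  have hs0 : 0 < s := hs0.lt_of_ne (by rintro rfl; simp at hx)
  have hs1 : s < 1 := hs1.lt_of_ne (by rintro rfl; simp at hy)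
  have hxy : y - x ≠ 0 := fun h => hx (by rw [h]; simp)
  have hn : 0 < ‖y - x‖ := norm_pos_iff.2 hxy
  refine ⟨min s (1 - s) * ‖y - x‖, mul_pos (lt_min hs0 (by linarith)) hn, fun q hq => ?_⟩
  constructor
  · intro h
    exact cross_mem_line (segment_subset_line hp) (segment_subset_line h)
  · intro h
    obtain ⟨t, ht⟩ := exists_smul_of_cross_eq_zero hxy h
    rw [Metric.mem_ball, dist_eq_norm, ht, norm_smul, Real.norm_eq_abs] at hq
    have h1 := lt_of_mul_lt_mul_right hq hn.le
    have h2 := abs_lt.1 (h1.trans_le (min_le_left _ _))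
    have h3 := abs_lt.1 (h1.trans_le (min_le_right _ _))
    refine mem_segment_iff_exists.2 ⟨s + t, by linarith, by linarith, ?_⟩
    rw [sub_eq_iff_eq_add.1 ht]; module

/-! ### Arcs -/

theorem IsArc.symm {C : Set Plane} {a b : Plane} (h : IsArc C a b) : IsArc C b a := by
  obtain ⟨γ, hi, hr⟩ := h
  refine ⟨γ.symm, ?_, by rw [Path.symm_range, hr]⟩
  exact hi.comp unitInterval.symm_bijective.injective

theorem isArc_segment {a b : Plane} (h : a ≠ b) : IsArc (segment ℝ a b) a b := by
  refine ⟨⟨⟨fun t => a + (t : ℝ) • (b - a), by fun_prop⟩, by simp, by simp⟩, ?_, ?_⟩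
  · intro s t hst
    have h1 : (s : ℝ) • (b - a) = (t : ℝ) • (b - a) := add_left_cancel hst
    exact Subtype.ext (smul_left_injective ℝ (sub_ne_zero.2 h.symm) h1)
  · ext p
    rw [mem_segment_iff_exists]
    constructor
    · rintro ⟨t, rfl⟩; exact ⟨t, t.2.1, t.2.2, rfl⟩
    · rintro ⟨t, h0, h1, rfl⟩; exact ⟨⟨t, h0, h1⟩, rfl⟩

theorem IsArc.trans {C D : Set Plane} {a b c : Plane} (hC : IsArc C a b) (hD : IsArc D b c)
    (h : D ∩ C ⊆ {b}) : IsArc (C ∪ D) a c := by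
  obtain ⟨γ, hγ, rfl⟩ := hC
  obtain ⟨δ, hδ, rfl⟩ := hD
  refine ⟨γ.trans δ, ?_, Path.trans_range γ δ⟩
  have key : ∀ s t : unitInterval, (s : ℝ) ≤ 1 / 2 → ¬ (t : ℝ) ≤ 1 / 2 →
      (γ.trans δ) s ≠ (γ.trans δ) t := by
    intro s t hs ht hst
    rw [Path.trans_apply, Path.trans_apply, dif_pos hs, dif_neg ht] at hst
    have h2 := h ⟨mem_range_self _, by rw [← hst]; exact mem_range_self _⟩
    have h4 := hδ ((show _ = b from h2).trans δ.source.symm)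
    have h5 : 2 * (t : ℝ) - 1 = 0 := congrArg Subtype.val h4
    exact ht (by linarith)
  intro s t hst
  by_cases hs : (s : ℝ) ≤ 1 / 2 <;> by_cases ht : (t : ℝ) ≤ 1 / 2
  · rw [Path.trans_apply, Path.trans_apply, dif_pos hs, dif_pos ht] at hst
    have h5 : 2 * (s : ℝ) = 2 * t := congrArg Subtype.val (hγ hst)
    exact Subtype.ext (by linarith)
  · exact absurd hst (key s t hs ht)
  · exact absurd hst.symm (key t s ht hs)
  · rw [Path.trans_apply, Path.trans_apply, dif_neg hs, dif_neg ht] at hst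
    have h5 : 2 * (s : ℝ) - 1 = 2 * t - 1 := congrArg Subtype.val (hδ hst)
    exact Subtype.ext (by linarith)

theorem IsArc.isCompact {C : Set Plane} {a b : Plane} (h : IsArc C a b) : IsCompact C := by
  obtain ⟨γ, -, rfl⟩ := h
  exact isCompact_range γ.continuous

theorem IsArc.left_mem {C : Set Plane} {a b : Plane} (h : IsArc C a b) : a ∈ C := by
  obtain ⟨γ, -, rfl⟩ := h
  exact ⟨0, γ.source⟩

theorem IsArc.right_mem {C : Set Plane} {a b : Plane} (h : IsArc C a b) : b ∈ C :=
  h.symm.left_mem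

/-- `PolyArc L a C b N`: the set `C` is a polygonal Jordan arc from `a` to `b` with set of
nodes `N`, each of whose segments has an end point outside `L`. -/
inductive PolyArc (L : Set Plane) (a : Plane) : Set Plane → Plane → Set Plane → Prop
  | segment {b : Plane} (hab : a ≠ b) (hL : a ∉ L ∨ b ∉ L) :
      PolyArc L a (segment ℝ a b) b {a, b}
  | snoc {C : Set Plane} {b c : Plane} {N : Set Plane} (h : PolyArc L a C b N) (hbc : b ≠ c)
      (hL : b ∉ L ∨ c ∉ L) (hC : _root_.segment ℝ b c ∩ C ⊆ {b}) :
      PolyArc L a (C ∪ _root_.segment ℝ b c) c (insert c N)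

namespace PolyArc

variable {L : Set Plane} {a b : Plane} {C N : Set Plane}

theorem isArc (h : PolyArc L a C b N) : IsArc C a b := by
  induction h with
  | segment hab _ => exact isArc_segment hab
  | snoc _ hbc _ hC ih => exact ih.trans (isArc_segment hbc) hC

theorem isClosed (h : PolyArc L a C b N) : IsClosed C := h.isArc.isCompact.isClosed

theorem finite_nodes (h : PolyArc L a C b N) : N.Finite := by
  induction h with
  | segment _ _ => exact Set.toFinite _
  | snoc _ _ _ _ ih => exact ih.insert _

theorem right_mem_nodes (h : PolyArc L a C b N) : b ∈ N := by
  cases h <;> simp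

theorem finite_inter_spanLines {M : Set Plane} (hM : M.Finite)
    (h : PolyArc (spanLines M) a C b N) : (C ∩ spanLines M).Finite := by
  induction h with
  | segment _ hL => exact finite_segment_inter_spanLines hM hL
  | snoc _ _ hL _ ih =>
    rw [union_inter_distrib_right]
    exact ih.union (finite_segment_inter_spanLines hM hL)

/-- Brings arcs into the form needed by `accessible_compl_segments`. -/
theorem exists_eq_biUnion (h : PolyArc L a C b N) :
    ∃ F : Set (Plane × Plane), F.Finite ∧ C = ⋃ z ∈ F, _root_.segment ℝ z.1 z.2 := by
  induction h with
  | @segment b hab _ => exact ⟨{(a, b)}, finite_singleton _, by simp⟩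
  | @snoc C b c N _ hbc _ hC ih =>
    obtain ⟨F, hF, rfl⟩ := ih
    refine ⟨insert (b, c) F, hF.insert _, ?_⟩
    rw [biUnion_insert, union_comm]

/-- Successive pieces meet only in nodes, so a point that is no node lies on one segment, and the
closed rest of the arc keeps a positive distance from it. -/
theorem locallyLineAt (h : PolyArc L a C b N) {p : Plane} (hp : p ∈ C) (hpN : p ∉ N) :
    ∃ x ∈ N, ∃ y ∈ N, x ≠ y ∧ (x ∉ L ∨ y ∉ L) ∧ p ∈ line x y ∧
      LocallyLineAt C p (y - x) := by
  induction h with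
  | @segment b hab hL =>
    simp only [mem_insert_iff, mem_singleton_iff, not_or] at hpN
    exact ⟨a, by simp, b, by simp, hab, hL, segment_subset_line hp,
      locallyLineAt_segment hp hpN.1 hpN.2⟩
  | @snoc C b c N h hbc hL hC ih =>
    simp only [mem_insert_iff, not_or] at hpN
    have hpb : p ≠ b := fun hb => hpN.2 (hb ▸ h.right_mem_nodes)
    by_cases hpC : p ∈ C
    · obtain ⟨x, hx, y, hy, hxy, hL', hl, hloc⟩ := ih hpC hpN.2
      exact ⟨x, Or.inr hx, y, Or.inr hy, hxy, hL', hl,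
        hloc.union (isClosed_segment b c) fun hs => hpb (hC ⟨hs, hpC⟩)⟩
    · have hs : p ∈ _root_.segment ℝ b c := hp.resolve_left hpC
      refine ⟨b, Or.inr h.right_mem_nodes, c, Or.inl rfl, hbc, hL, segment_subset_line hs, ?_⟩
      rw [union_comm]
      exact (locallyLineAt_segment hs hpb hpN.1).union h.isClosed hpC

/-- `PolyArc` grows only at its far end; prepending a segment is what makes reversal possible. -/
theorem cons (h : PolyArc L a C b N) {a' : Plane} (hne : a' ≠ a) (hL : a' ∉ L ∨ a ∉ L)
    (hC : _root_.segment ℝ a' a ∩ C ⊆ {a}) :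
    PolyArc L a' (_root_.segment ℝ a' a ∪ C) b (insert a' N) := by
  induction h with
  | @segment b hab hL' =>
    have := (PolyArc.segment hne hL).snoc hab hL' (by rwa [inter_comm])
    convert this using 1
    ext; simp; tauto
  | @snoc C b c N h hbc hL' hC' ih =>
    have h1 := (ih ((inter_subset_inter_right _ subset_union_left).trans hC)).snoc hbc hL' (by
      rintro x ⟨hx, hx' | hx'⟩
      · have : x = a := hC ⟨hx', Or.inr hx⟩
        subst this
        exact hC' ⟨hx, h.isArc.left_mem⟩
      · exact hC' ⟨hx, hx'⟩)
    rw [union_assoc, insert_comm] at h1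
    exact h1

theorem symm (h : PolyArc L a C b N) : PolyArc L b C a N := by
  induction h with
  | @segment b hab hL =>
    rw [segment_symm, pair_comm]
    exact .segment hab.symm hL.symm
  | @snoc C b c N h hbc hL hC ih =>
    rw [union_comm, segment_symm]
    exact ih.cons hbc.symm hL.symm (by rwa [segment_symm])

end PolyArc

/-- A polygonal arc with nodes in `M` and one with no interior nodes on the lines spanned by `M`
cross properly. -/
theorem PolyArc.crossProperlyAt {L M C D N N' : Set Plane} {a b c d p : Plane}
    (hC : PolyArc L a C b N) (hN : N ⊆ M) (hD : PolyArc (spanLines M) c D d N')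
    (hN' : N' ∩ spanLines M ⊆ {c, d}) (hDM : D ∩ M ⊆ {c, d}) (hpC : p ∈ C) (hpD : p ∈ D)
    (hpc : p ≠ c) (hpd : p ≠ d) :
    p ∈ spanLines M ∧ CrossProperlyAt C D p ∧ CrossProperlyAt D C p := by
  have hpcd : p ∉ ({c, d} : Set Plane) := by simp [hpc, hpd]
  have hpM : p ∉ M := fun h => hpcd (hDM ⟨hpD, h⟩)
  obtain ⟨x, hx, y, hy, hxy, -, hl, hloc⟩ := hC.locallyLineAt hpC fun h => hpM (hN h)
  have hpL : p ∈ spanLines M := ⟨x, hN hx, y, hN hy, hl⟩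
  obtain ⟨x', -, y', -, hxy', hL', hl', hloc'⟩ :=
    hD.locallyLineAt hpD fun h => hpcd (hN' ⟨h, hpL⟩)
  -- If the directions were parallel, both segments would lie on one line through p, spanned by M,
  -- although the segment of D has an end off all such lines.
  have hcr : cross (y - x) (y' - x') ≠ 0 := by
    intro h0
    have hmem : ∀ q ∈ line x' y', q ∈ spanLines M := by
      intro q hq
      refine ⟨x, hN hx, y, hN hy, mem_line_of_cross hxy hl ?_⟩
      obtain ⟨s, rfl⟩ := hl'
      obtain ⟨t, rfl⟩ := hq
      have : cross (y - x) (x' + t • (y' - x') - (x' + s • (y' - x')))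
          = (t - s) * cross (y - x) (y' - x') := by simp [cross]; ring
      rw [this, h0, mul_zero]
    rcases hL' with h | h
    · exact h (hmem _ (left_mem_line _ _))
    · exact h (hmem _ (right_mem_line _ _))
  have hcr' : cross (y' - x') (y - x) ≠ 0 := by
    intro h0; apply hcr; unfold cross at h0 ⊢; linarith
  exact ⟨hpL, crossProperlyAt_of_locallyLineAt hloc hloc' hcr',
    crossProperlyAt_of_locallyLineAt hloc' hloc hcr⟩

section GenericArcs

/-! ### Generic polygonal arcs in open connected sets -/

theorem exists_first_mem_segment {x y : Plane} {K : Set Plane} (hK : IsClosed K)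
    (hne : (segment ℝ x y ∩ K).Nonempty) :
    ∃ z ∈ segment ℝ x y, z ∈ K ∧ segment ℝ x z ⊆ segment ℝ x y ∧ segment ℝ x z ∩ K ⊆ {z} := by
  have hcont : Continuous fun t : ℝ => x + t • (y - x) := by fun_prop
  have hc : IsCompact (Icc (0 : ℝ) 1 ∩ (fun t : ℝ => x + t • (y - x)) ⁻¹' K) :=
    isCompact_Icc.inter_right (hK.preimage hcont)
  obtain ⟨p, hp, hpK⟩ := hne
  obtain ⟨t, ht0, ht1, rfl⟩ := mem_segment_iff_exists.1 hp
  obtain ⟨s, ⟨⟨hs0, hs1⟩, hsK⟩, hmin⟩ := hc.exists_isLeast ⟨t, ⟨ht0, ht1⟩, hpK⟩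
  have hz : x + s • (y - x) ∈ segment ℝ x y := mem_segment_iff_exists.2 ⟨s, hs0, hs1, rfl⟩
  refine ⟨x + s • (y - x), hz, hsK,
    (convex_segment x y).segment_subset (left_mem_segment ℝ x y) hz, ?_⟩
  rintro q ⟨hq, hqK⟩
  obtain ⟨r, hr0, hr1, rfl⟩ := mem_segment_iff_exists.1 hq
  have e : x + r • (x + s • (y - x) - x) = x + (r * s) • (y - x) := by module
  rw [e] at hqK ⊢
  have hrs : r * s ≤ s := mul_le_of_le_one_left hs0 hr1
  have h1 : s ≤ r * s := hmin ⟨⟨mul_nonneg hr0 hs0, hrs.trans hs1⟩, hqK⟩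
  rw [hrs.antisymm h1]; rfl

/-- Truncation of a polygonal arc at its first point in a closed set. -/
theorem PolyArc.exists_truncation {L C N K : Set Plane} {a b : Plane} (h : PolyArc L a C b N)
    (hK : IsClosed K) (ha : a ∉ K) (hne : (C ∩ K).Nonempty)
    (hL : ∀ q ∈ C, q ∈ K → q ∉ L) :
    ∃ C' z N', PolyArc L a C' z N' ∧ C' ⊆ C ∧ z ∈ K ∧ N' ⊆ insert z N ∧ K ∩ C' ⊆ {z} := by
  induction h with
  | @segment b hab _ =>
    obtain ⟨z, hz, hzK, hsub, hinter⟩ := exists_first_mem_segment hK hne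
    -- The cut point z is a new node; the last segment stays generic because z itself lies outside
    -- L.
    refine ⟨_, z, _, .segment (fun h => ha (h ▸ hzK)) (Or.inr (hL z hz hzK)), hsub, hzK, ?_,
      by rwa [inter_comm]⟩
    rintro q (rfl | rfl) <;> simp
  | @snoc C b c N h hbc _ hC ih =>
    by_cases hCK : (C ∩ K).Nonempty
    · obtain ⟨C', z, N', h1, h2, h3, h4, h5⟩ := ih hCK fun q hq => hL q (Or.inl hq)
      exact ⟨C', z, N', h1, h2.trans subset_union_left, h3,
        h4.trans (insert_subset_insert (subset_insert _ _)), h5⟩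
    · have hCK' : ∀ q ∈ C, q ∉ K := fun q hq hqK => hCK ⟨q, hq, hqK⟩
      have hne' : (_root_.segment ℝ b c ∩ K).Nonempty := by
        obtain ⟨q, hq | hq, hqK⟩ := hne
        · exact absurd hqK (hCK' q hq)
        · exact ⟨q, hq, hqK⟩
      obtain ⟨z, hz, hzK, hsub, hinter⟩ := exists_first_mem_segment hK hne'
      refine ⟨_, z, _, h.snoc (c := z) (fun hb => hCK' b h.isArc.right_mem (hb ▸ hzK))
        (Or.inr (hL z (Or.inr hz) hzK)) ((inter_subset_inter_left _ hsub).trans hC),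
        union_subset_union_right _ hsub, hzK, insert_subset_insert (subset_insert _ _), ?_⟩
      rintro q ⟨hqK, hq | hq⟩
      · exact absurd hqK (hCK' q hq)
      · exact hinter ⟨hq, hqK⟩

/-- A point `a` is accessible from `U` if an open set of points sees `a` within `U`. -/
def Accessible (U : Set Plane) (a : Plane) : Prop :=
  ∃ W : Set Plane, IsOpen W ∧ W.Nonempty ∧ ∀ c ∈ W, ∀ y ∈ segment ℝ a c, y ≠ a → y ∈ U

/-- A generic polygonal arc from `a` through `U` to a point `b`. -/
structure IsGenericPath (U M : Set Plane) (a : Plane) (C : Set Plane) (b : Plane)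
    (N : Set Plane) : Prop where
  arc : PolyArc (spanLines M) a C b N
  nodes : N ∩ spanLines M ⊆ {a}
  avoid : C ∩ M ⊆ {a}
  subset : C ⊆ insert a U
  end_notMem : b ∉ spanLines M

variable {U M : Set Plane} {a : Plane}

/-- Choose c off the lines spanned by M and off the lines joining b to points of M or to points of C
on spanned lines. The segment from b to c then misses all those points. Cutting C at its first point
z on this segment and continuing straight to c keeps the arc simple and generic. -/
theorem IsGenericPath.extend (hM : M.Finite) (ha : a ∈ M) {C N : Set Plane}
    {b : Plane} (h : IsGenericPath U M a C b N) {O W : Set Plane} (hO : Convex ℝ O) (hOU : O ⊆ U)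
    (hb : b ∈ O) (hW : IsOpen W) (hWne : W.Nonempty) (hWO : W ⊆ O)
    {F : Set (Plane × Plane)} (hF : F.Finite) :
    ∃ c ∈ W, (∀ z ∈ F, c ∉ line z.1 z.2) ∧
      ∃ C' N', IsGenericPath U M a C' c N' ∧ C' ⊆ C ∪ segment ℝ b c := by
  have hfin := h.arc.finite_inter_spanLines hM
  obtain ⟨c, hcW, hc⟩ := exists_mem_not_mem_lines
    (hF.union ((hM.prod hM).union ((finite_singleton b).prod (hM.union hfin)))) hW hWne
  have hcL : c ∉ spanLines M := by
    rintro ⟨x, hx, y, hy, hl⟩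
    exact hc (x, y) (Or.inr (Or.inl ⟨hx, hy⟩)) hl
  have hseg : ∀ m ∈ M ∪ (C ∩ spanLines M), m ∉ segment ℝ b c := by
    intro m hm hmb
    have hne : m ≠ b := by
      rintro rfl
      rcases hm with hm | hm
      · exact h.end_notMem (subset_spanLines M hm)
      · exact h.end_notMem hm.2
    exact hc (b, m) (Or.inr (Or.inr ⟨rfl, hm⟩)) (mem_line_of_mem_segment hmb hne)
  have hsegO : segment ℝ b c ⊆ O := hO.segment_subset hb (hWO hcW)
  obtain ⟨C', z, N', h1, h2, h3, h4, h5⟩ := h.arc.exists_truncation (isClosed_segment b c)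
    (hseg a (Or.inl ha)) ⟨b, h.arc.isArc.right_mem, left_mem_segment ℝ b c⟩
    (fun q hq hqs hqL => hseg q (Or.inr ⟨hq, hqL⟩) hqs)
  have hzL : z ∉ spanLines M := fun hzL => hseg z (Or.inr ⟨h2 h1.isArc.right_mem, hzL⟩) h3
  have hN' : N' ∩ spanLines M ⊆ {a} := by
    rintro q ⟨hq, hqL⟩
    rcases h4 hq with rfl | hq
    · exact absurd hqL hzL
    · exact h.nodes ⟨hq, hqL⟩
  refine ⟨c, hcW, fun z hz => hc z (Or.inl hz), ?_⟩
  by_cases hzc : z = c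
  · subst hzc
    exact ⟨C', N', ⟨h1, hN', (inter_subset_inter_left _ h2).trans h.avoid, h2.trans h.subset, hcL⟩,
      h2.trans subset_union_left⟩
  · have hsub : segment ℝ z c ⊆ segment ℝ b c :=
      (convex_segment b c).segment_subset h3 (right_mem_segment ℝ b c)
    refine ⟨_, _, ⟨h1.snoc hzc (Or.inr hcL) ((inter_subset_inter_left _ hsub).trans h5), ?_, ?_,
      union_subset (h2.trans h.subset)
        (hsub.trans (hsegO.trans (hOU.trans (subset_insert _ _)))), hcL⟩,
      union_subset_union h2 hsub⟩
    · rintro q ⟨rfl | hq, hqL⟩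
      · exact absurd hqL hcL
      · exact hN' ⟨hq, hqL⟩
    · rintro q ⟨hq | hq, hqM⟩
      · exact h.avoid ⟨h2 hq, hqM⟩
      · exact absurd (hsub hq) (hseg q (Or.inl hqM))

/-- The points of U that are limits of ends of generic paths form a nonempty, open and relatively
closed subset of U. Only ends near x can be asked for, since x may itself lie on a spanned line. -/
theorem exists_isGenericPath (hM : M.Finite) (ha : a ∈ M) (hU : IsOpen U)
    (hUc : IsPreconnected U) (hacc : Accessible U a) {x : Plane} (hx : x ∈ U)
    {W : Set Plane} (hW : IsOpen W) (hxW : x ∈ W) :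
    ∃ C b N, b ∈ W ∧ IsGenericPath U M a C b N := by
  let T : Set Plane := {x | x ∈ U ∧ ∀ W, IsOpen W → x ∈ W →
    ∃ C b N, b ∈ W ∧ IsGenericPath U M a C b N}
  have hball : ∀ x ∈ U, ∀ y ∈ U, ∀ ε > 0, Metric.ball x ε ⊆ U → y ∈ Metric.ball x ε →
      (∃ C b N, b ∈ Metric.ball x ε ∧ IsGenericPath U M a C b N) → y ∈ T := by
    rintro x - y hy ε hε hb hyb ⟨C, b, N, hbb, h⟩
    refine ⟨hy, fun W hW hyW => ?_⟩
    obtain ⟨c, hc, -, C', N', h', -⟩ := h.extend hM ha (convex_ball x ε) hb hbb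
      (hW.inter Metric.isOpen_ball) ⟨y, hyW, hyb⟩ inter_subset_right finite_empty
    exact ⟨C', c, N', hc.1, h'⟩
  have hTo : IsOpen T := by
    rw [Metric.isOpen_iff]
    rintro x ⟨hxU, hx⟩
    obtain ⟨ε, hε, hb⟩ := Metric.isOpen_iff.1 hU x hxU
    refine ⟨ε, hε, fun y hy => hball x hxU y (hb hy) ε hε hb hy ?_⟩
    exact hx _ Metric.isOpen_ball (Metric.mem_ball_self hε)
  have hTne : (U ∩ T).Nonempty := by
    obtain ⟨W, hW, hWne, hWU⟩ := hacc
    obtain ⟨c, hcW, hc⟩ := exists_mem_not_mem_lines (hM.prod hM) hW hWne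
    have hcL : c ∉ spanLines M := by
      rintro ⟨x, hx, y, hy, hl⟩
      exact hc (x, y) ⟨hx, hy⟩ hl
    have hac : a ≠ c := by rintro rfl; exact hcL (subset_spanLines M ha)
    have hcU := hWU c hcW c (right_mem_segment ℝ a c) hac.symm
    refine ⟨c, hcU, hcU, fun W' _ hcW' => ⟨_, c, _, hcW', .segment hac (Or.inr hcL), ?_, ?_, ?_,
      hcL⟩⟩
    · rintro q ⟨rfl | rfl, hq⟩
      · rfl
      · exact absurd hq hcL
    · rintro q ⟨hq, hqM⟩
      by_contra hqa
      exact hcL ⟨a, ha, q, hqM, mem_line_of_mem_segment hq hqa⟩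
    · intro q hq
      by_cases hqa : q = a
      · exact Or.inl hqa
      · exact Or.inr (hWU c hcW q hq hqa)
  have hcl : closure T ∩ U ⊆ T := by
    rintro x ⟨hxT, hxU⟩
    obtain ⟨ε, hε, hb⟩ := Metric.isOpen_iff.1 hU x hxU
    obtain ⟨y, hyb, hyT⟩ := mem_closure_iff.1 hxT _ Metric.isOpen_ball (Metric.mem_ball_self hε)
    exact hball x hxU x hxU ε hε hb (Metric.mem_ball_self hε) (hyT.2 _ Metric.isOpen_ball hyb)
  exact (hUc.subset_of_closure_inter_subset hTo hTne hcl hx).2 W hW hxW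

/-- A polygonal arc from `a` to `v` in general position with respect to `M`. -/
structure IsGenericArc (M : Set Plane) (C : Set Plane) (a v : Plane) (N : Set Plane) : Prop where
  arc : PolyArc (spanLines M) a C v N
  nodes : N ∩ spanLines M ⊆ {a, v}
  avoid : C ∩ M ⊆ {a, v}

/-- Two points accessible from an open connected set `U` are joined by a generic polygonal arc
through `U`. -/
theorem exists_isGenericArc (hM : M.Finite) {v : Plane} (hav : a ≠ v) (ha : a ∈ M) (hv : v ∈ M)
    (hU : IsOpen U) (hUc : IsPreconnected U) (hvU : v ∉ U)
    (hacc : Accessible U a) (hacc' : Accessible U v) :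
    ∃ C N, IsGenericArc M C a v N ∧ C ⊆ U ∪ {a, v} := by
  obtain ⟨W, hW, hWne, hWU⟩ := hacc'
  have hvL : v ∈ spanLines M := subset_spanLines M hv
  have hWU' : ∀ c ∈ W, c ≠ v → c ∈ U := fun c hc hcv =>
    hWU c hc c (right_mem_segment ℝ v c) hcv
  -- The degenerate line from v to v is just v, so this picks a point of W other than v.
  obtain ⟨x, hxW, hx⟩ := exists_mem_not_mem_lines (finite_singleton (v, v)) hW hWne
  have hxv : x ≠ v := by rintro rfl; exact hx _ rfl (left_mem_line _ _)
  obtain ⟨C, b, N, ⟨hbW, hbU⟩, h⟩ := exists_isGenericPath hM ha hU hUc hacc (hWU' x hxW hxv)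
    (hW.inter hU) ⟨hxW, hWU' x hxW hxv⟩
  obtain ⟨ε, hε, hball⟩ := Metric.isOpen_iff.1 (hW.inter hU) b ⟨hbW, hbU⟩
  have hfin := h.arc.finite_inter_spanLines hM
  have hbv : b ≠ v := by rintro rfl; exact hvU hbU
  have hvC : v ∉ C := fun hvC => (h.subset hvC).elim (fun h => hav h.symm) hvU
  -- One more extension moves the end to a point c whose segment to v meets the path only off the
  -- spanned lines. The extra lines exclude old bad points on that segment and an overlap with the
  -- segment from b to c.
  obtain ⟨c, hc, hcF, C₁, N₁, h₁, hC₁⟩ := h.extend hM ha (convex_ball b ε)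
    (hball.trans inter_subset_right) (Metric.mem_ball_self hε) Metric.isOpen_ball
    ⟨b, Metric.mem_ball_self hε⟩ Subset.rfl
    (((finite_singleton v).prod hfin).union (finite_singleton (b, v)))
  have hcL := h₁.end_notMem
  have hcv : c ≠ v := by rintro rfl; exact hcL hvL
  have hKU : ∀ y ∈ segment ℝ v c, y ≠ v → y ∈ U := hWU c (hball hc).1
  have hKM : segment ℝ v c ∩ M ⊆ {v} := by
    rintro m ⟨hm, hmM⟩
    by_contra hmv
    exact hcL ⟨v, hv, m, hmM, mem_line_of_mem_segment hm hmv⟩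
  have haK : a ∉ segment ℝ v c := fun h => hav (hKM ⟨h, ha⟩)
  have hKL : ∀ q ∈ C₁, q ∈ segment ℝ v c → q ∉ spanLines M := by
    intro q hq hqK hqL
    rcases hC₁ hq with hqC | hqs
    · have hqv : q ≠ v := by rintro rfl; exact hvC hqC
      exact hcF (v, q) (Or.inl ⟨rfl, hqC, hqL⟩) (mem_line_of_mem_segment hqK hqv)
    · have hqc : q ≠ c := by rintro rfl; exact hcL hqL
      rw [segment_symm] at hqs hqK
      have hbl := mem_line_of_mem_segment hqs hqc
      have hvl := mem_line_of_mem_segment hqK hqc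
      refine hcF (b, v) (Or.inr rfl) (mem_line_of_cross hbv (left_mem_line b v) ?_)
      obtain ⟨s, hs⟩ := hbl
      obtain ⟨t, ht⟩ := hvl
      rw [hs, ht]
      simp [cross]; ring
  obtain ⟨C', z, N', h1, h2, h3, h4, h5⟩ := h₁.arc.exists_truncation (isClosed_segment v c) haK
    ⟨c, h₁.arc.isArc.right_mem, right_mem_segment ℝ v c⟩ hKL
  have hzL : z ∉ spanLines M := hKL z (h2 h1.isArc.right_mem) h3
  have hzv : z ≠ v := by rintro rfl; exact hzL hvL
  have hsub : segment ℝ z v ⊆ segment ℝ v c :=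
    (convex_segment v c).segment_subset h3 (left_mem_segment ℝ v c)
  refine ⟨_, _, ⟨h1.snoc hzv (Or.inl hzL) ((inter_subset_inter_left _ hsub).trans h5), ?_, ?_⟩, ?_⟩
  · rintro q ⟨rfl | hq, hqL⟩
    · simp
    · rcases h4 hq with rfl | hq
      · exact absurd hqL hzL
      · exact Or.inl (h₁.nodes ⟨hq, hqL⟩)
  · rintro q ⟨hq | hq, hqM⟩
    · exact Or.inl (h₁.avoid ⟨h2 hq, hqM⟩)
    · exact Or.inr (hKM ⟨hsub hq, hqM⟩)
  · rintro q (hq | hq)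
    · exact (h₁.subset (h2 hq)).elim (fun h => Or.inr (Or.inl h)) Or.inl
    · by_cases hqv : q = v
      · exact Or.inr (Or.inr hqv)
      · exact Or.inl (hKU q (hsub hq) hqv)

end GenericArcs

/-! ### Disjoint corridors around the edges of a planar drawing -/

theorem exists_last_crossing {g : ℝ → ℝ} (hg : Continuous g) {a b r : ℝ} (hab : a ≤ b)
    (ha : g a ≤ r) (hb : r ≤ g b) :
    ∃ t ∈ Icc a b, g t = r ∧ ∀ s ∈ Icc t b, r ≤ g s := by
  have hc : IsCompact (Icc a b ∩ g ⁻¹' Iic r) :=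
    isCompact_Icc.inter_right (isClosed_Iic.preimage hg)
  obtain ⟨t, ⟨ht, htr⟩, hmax⟩ := hc.exists_isGreatest ⟨a, ⟨le_rfl, hab⟩, ha⟩
  obtain ⟨t', ht', hgt'⟩ := intermediate_value_Icc ht.2 hg.continuousOn ⟨htr, hb⟩
  have htt' : t' ≤ t := hmax ⟨⟨ht.1.trans ht'.1, ht'.2⟩, hgt'.le⟩
  have heq : t' = t := htt'.antisymm ht'.1
  have hgt : g t = r := heq ▸ hgt'
  refine ⟨t, ht, hgt, fun s hs => ?_⟩
  by_contra! hlt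
  have : s ≤ t := hmax ⟨⟨ht.1.trans hs.1, hs.2⟩, hlt.le⟩
  rw [this.antisymm hs.1, hgt] at hlt
  exact lt_irrefl _ hlt

theorem exists_first_crossing {g : ℝ → ℝ} (hg : Continuous g) {a b r : ℝ} (hab : a ≤ b)
    (ha : r ≤ g a) (hb : g b ≤ r) :
    ∃ t ∈ Icc a b, g t = r ∧ ∀ s ∈ Icc a t, r ≤ g s := by
  obtain ⟨t, ht, hgt, h⟩ := exists_last_crossing (hg.comp continuous_neg) (r := r)
    (neg_le_neg hab) (by simpa using hb) (by simpa using ha)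
  refine ⟨-t, ⟨by linarith [ht.2], by linarith [ht.1]⟩, hgt, fun s hs => ?_⟩
  simpa using h (-s) ⟨by linarith [hs.2], by linarith [hs.1]⟩

/-- The part of an arc between small circles around its end points. -/
theorem IsArc.exists_middle {C : Set Plane} {a b : Plane} (h : IsArc C a b) {r : ℝ} (hr : 0 < r)
    (hab : 2 * r ≤ dist a b) :
    ∃ K x y, IsCompact K ∧ IsPreconnected K ∧ K ⊆ C ∧ x ∈ K ∧ y ∈ K ∧ dist x a = r ∧
      dist y b = r ∧ ∀ z ∈ K, r ≤ dist z a ∧ r ≤ dist z b := by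
  obtain ⟨γ, -, rfl⟩ := h
  have hf : Continuous γ.extend := γ.continuous_extend
  have ha0 : γ.extend 0 = a := γ.extend_zero
  have hb1 : γ.extend 1 = b := γ.extend_one
  obtain ⟨t, ht, htr, ht'⟩ := exists_last_crossing (g := fun t => dist (γ.extend t) a) (r := r)
    (hf.dist continuous_const) zero_le_one (by simp [ha0, hr.le])
    (by rw [hb1, dist_comm]; linarith)
  -- After the last visit to the circle around a, stop at the first visit to the circle around b. At
  -- time t the curve is still at distance at least r from b, since a and b are 2r apart.
  obtain ⟨s, hs, hsr, hs'⟩ := exists_first_crossing (g := fun t => dist (γ.extend t) b) (r := r)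
    (hf.dist continuous_const) ht.2
    (by
      have := dist_triangle_left a b (γ.extend t)
      linarith)
    (by simp [hb1, hr.le])
  refine ⟨γ.extend '' Icc t s, γ.extend t, γ.extend s, isCompact_Icc.image hf,
    isPreconnected_Icc.image _ hf.continuousOn, ?_, ⟨t, ⟨le_rfl, hs.1⟩, rfl⟩,
    ⟨s, ⟨hs.1, le_rfl⟩, rfl⟩, htr, hsr, ?_⟩
  · rw [← γ.extend_range]; exact image_subset_range _ _
  · rintro _ ⟨u, hu, rfl⟩
    exact ⟨ht' u ⟨hu.1, hu.2.trans hs.2⟩, hs' u hu⟩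

/-- The union of the segments from `u` to the points of the ball of radius `δ` around `m`,
without `u`. -/
def openCone (u m : Plane) (δ : ℝ) : Set Plane :=
  {x | ∃ k : ℝ, 1 ≤ k ∧ dist (u + k • (x - u)) m < δ}

theorem isOpen_openCone (u m : Plane) (δ : ℝ) : IsOpen (openCone u m δ) := by
  have : openCone u m δ = ⋃ k ∈ Ici (1 : ℝ), {x | dist (u + k • (x - u)) m < δ} := by
    ext; simp [openCone]
  rw [this]
  exact isOpen_biUnion fun k _ => isOpen_lt (by fun_prop) continuous_const

theorem ball_subset_openCone (u m : Plane) (δ : ℝ) : Metric.ball m δ ⊆ openCone u m δ :=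
  fun x hx => ⟨1, le_rfl, by simpa using hx⟩

/-- Each point slides outwards along its ray from u into the ball around m, which is convex. -/
theorem isPreconnected_openCone (u m : Plane) {δ : ℝ} (hδ : 0 < δ) :
    IsPreconnected (openCone u m δ) := by
  refine isPreconnected_of_forall m fun x hx => ?_
  obtain ⟨k, hk, hkx⟩ := hx
  refine ⟨Metric.ball m δ ∪ segment ℝ x (u + k • (x - u)), ?_, Or.inl (Metric.mem_ball_self hδ),
    Or.inr (left_mem_segment ℝ _ _), ?_⟩
  · refine union_subset (ball_subset_openCone u m δ) fun q hq => ?_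
    obtain ⟨t, ht0, ht1, rfl⟩ := mem_segment_iff_exists.1 hq
    have hj : 1 ≤ 1 + t * (k - 1) := by nlinarith
    have hjk : 1 + t * (k - 1) ≤ k := by nlinarith
    refine ⟨k / (1 + t * (k - 1)), (one_le_div (by linarith)).2 hjk, ?_⟩
    have e : x + t • (u + k • (x - u) - x) - u = (1 + t * (k - 1)) • (x - u) := by module
    rw [e, smul_smul, div_mul_cancel₀ _ (by linarith)]
    exact hkx
  · exact IsPreconnected.union _ hkx (right_mem_segment ℝ _ _)
      (convex_ball m δ).isPreconnected (convex_segment _ _).isPreconnected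

theorem mem_openCone_of_mem_segment {u m c y : Plane} {δ : ℝ} (hc : c ∈ Metric.ball m δ)
    (hy : y ∈ segment ℝ u c) (hne : y ≠ u) : y ∈ openCone u m δ := by
  obtain ⟨t, ht0, ht1, rfl⟩ := mem_segment_iff_exists.1 hy
  have ht : t ≠ 0 := by rintro rfl; simp at hne
  have ht0 : 0 < t := ht0.lt_of_ne ht.symm
  refine ⟨t⁻¹, (one_le_inv₀ ht0).2 ht1, ?_⟩
  rw [add_sub_cancel_left, smul_smul, inv_mul_cancel₀ ht]
  simpa using hc

/-- Two points on a ray from `u` are as far apart as their distances to `u` differ. -/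
theorem dist_ray (u x : Plane) {j k : ℝ} (hj : 0 ≤ j) (hk : 0 ≤ k) :
    dist (u + j • (x - u)) (u + k • (x - u)) =
      |dist (u + j • (x - u)) u - dist (u + k • (x - u)) u| := by
  simp only [dist_eq_norm, add_sub_cancel_left, add_sub_add_left_eq_sub, ← sub_smul, norm_smul,
    Real.norm_eq_abs, abs_of_nonneg hj, abs_of_nonneg hk, ← sub_mul, abs_mul, abs_norm]

theorem exists_pos_of_forall_eventually {ι : Type*} [Finite ι] {P : ι → ℝ → Prop}
    (h : ∀ i, ∃ ε > 0, ∀ δ, 0 < δ → δ ≤ ε → P i δ) : ∃ δ > 0, ∀ i, P i δ := by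
  have h1 : ∀ i, ∀ᶠ δ in 𝓝[>] (0 : ℝ), P i δ := by
    intro i
    obtain ⟨ε, hε, h⟩ := h i
    filter_upwards [Ioc_mem_nhdsGT hε] with δ hδ using h δ hδ.1 hδ.2
  obtain ⟨δ, h2, h3⟩ := ((Filter.eventually_all.2 h1).and self_mem_nhdsWithin).exists
  exact ⟨δ, h3, h2⟩

/-- The factor 4 leaves room for cones of radius below r + δ at distinct vertices; the factor 2
keeps an edge away from vertices not on it. -/
theorem exists_vertex_radius {V E : Type*} [Finite V] [Finite E] {p : V → Plane}
    (hp : Function.Injective p) {c : E → Set Plane} (hc : ∀ e, IsClosed (c e)) :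
    ∃ r > 0, (∀ u v, u ≠ v → 4 * r ≤ dist (p u) (p v)) ∧
      ∀ e u, p u ∉ c e → ∀ x ∈ c e, 2 * r ≤ dist x (p u) := by
  obtain ⟨r, hr, h1⟩ := exists_pos_of_forall_eventually
    (P := fun (i : (V × V) ⊕ (E × V)) r => i.elim
      (fun i => i.1 ≠ i.2 → 4 * r ≤ dist (p i.1) (p i.2))
      (fun i => p i.2 ∉ c i.1 → ∀ x ∈ c i.1, 2 * r ≤ dist x (p i.2))) (by
    rintro (⟨u, v⟩ | ⟨e, u⟩)
    · by_cases huv : u = v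
      · exact ⟨1, one_pos, fun δ _ _ h => absurd huv h⟩
      · refine ⟨dist (p u) (p v) / 4, by
          have := dist_pos.2 (hp.ne huv); positivity, fun δ _ h _ => ?_⟩
        simp only; linarith
    · by_cases hu : p u ∈ c e
      · exact ⟨1, one_pos, fun δ _ _ h => absurd hu h⟩
      · obtain ⟨ε, hε, hb⟩ := Metric.isOpen_iff.1 (hc e).isOpen_compl _ hu
        refine ⟨ε / 2, by positivity, fun δ _ h _ x hx => ?_⟩
        by_contra! hlt
        exact hb (show dist x (p u) < ε by simp only at hlt; linarith) hx)
  exact ⟨r, hr, fun u v => h1 (.inl (u, v)), fun e u => h1 (.inr (e, u))⟩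

theorem exists_separation {E : Type*} [Finite E] {K : E → Set Plane} (hK : ∀ e, IsCompact (K e))
    (hdisj : ∀ e f, e ≠ f → Disjoint (K e) (K f)) {r : ℝ} (hr : 0 < r) :
    ∃ δ > 0, 4 * δ ≤ r ∧ ∀ e f, e ≠ f → ∀ x ∈ K e, ∀ y ∈ K f, 4 * δ ≤ dist x y := by
  obtain ⟨δ, hδ, h1⟩ := exists_pos_of_forall_eventually
    (P := fun (i : Option (E × E)) δ => match i with
      | none => 4 * δ ≤ r
      | some i => i.1 ≠ i.2 → ∀ x ∈ K i.1, ∀ y ∈ K i.2, 4 * δ ≤ dist x y) (by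
    rintro (_ | ⟨e, f⟩)
    · exact ⟨r / 4, by positivity, fun δ _ h => by simp only; linarith⟩
    · by_cases hef : e = f
      · exact ⟨1, one_pos, fun δ _ _ h => absurd hef h⟩
      · obtain ⟨ρ, hρ, h⟩ := Metric.exists_pos_forall_lt_edist (hK e) (hK f).isClosed
          (hdisj e f hef)
        refine ⟨ρ / 4, by positivity, fun δ _ h' _ x hx y hy => ?_⟩
        have h2 := h x hx y hy
        rw [edist_nndist, ENNReal.coe_lt_coe] at h2
        have h3 : (ρ : ℝ) < dist x y := h2
        linarith)
  exact ⟨δ, hδ, h1 none, fun e f => h1 (some (e, f))⟩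

section Regions

variable {V : Type*} {p : V → Plane} {r δ : ℝ}

theorem dist_lt_of_mem_openCone {u m x : Plane} (h : x ∈ openCone u m δ) (hm : dist m u = r) :
    dist x u < r + δ := by
  obtain ⟨k, hk, hkx⟩ := h
  have h1 := dist_triangle (u + k • (x - u)) m u
  have h2 : dist (u + k • (x - u)) u = k * dist x u := by
    simp [dist_eq_norm, norm_smul, abs_of_nonneg (zero_le_one.trans hk)]
  have h3 : 0 ≤ dist x u := dist_nonneg
  nlinarith

/-- A common ray would pass within δ of both m and m'. As these are equally far from u, the two ray
points are less than 2δ apart, so m and m' would be less than 4δ apart. -/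
theorem notMem_openCone {u m m' x : Plane} (h : x ∈ openCone u m δ) (hm : dist m u = r)
    (hm' : dist m' u = r) (hmm' : 4 * δ ≤ dist m m') : x ∉ openCone u m' δ := by
  rintro ⟨k', hk', hx'⟩
  obtain ⟨k, hk, hx⟩ := h
  have h1 := dist_ray u x (zero_le_one.trans hk) (zero_le_one.trans hk')
  have h2 := abs_sub_lt_iff.1 ((abs_dist_sub_le (u + k • (x - u)) m u).trans_lt hx)
  have h3 := abs_sub_lt_iff.1 ((abs_dist_sub_le (u + k' • (x - u)) m' u).trans_lt hx')
  have h4 : dist (u + k • (x - u)) (u + k' • (x - u)) < 2 * δ := by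
    rw [h1, abs_sub_lt_iff]; constructor <;> linarith
  have h5 := dist_triangle4 m (u + k • (x - u)) (u + k' • (x - u)) m'
  rw [dist_comm m (u + k • (x - u))] at h5
  linarith

/-- If x were in the cone, its radius would exceed r - δ while the ray point near m has radius below
r + δ. This puts m within δ + 2δ + δ of y. -/
theorem notMem_openCone_of_dist {u m x y : Plane} (hm : dist m u = r)
    (hyu : r ≤ dist y u) (hmy : 4 * δ ≤ dist m y) (hxy : dist x y < δ) :
    x ∉ openCone u m δ := by
  rintro ⟨k, hk, hx⟩
  have h1 := dist_ray u x (zero_le_one.trans hk) zero_le_one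
  have e : u + (1 : ℝ) • (x - u) = x := by simp
  rw [e] at h1
  have h2 := abs_sub_lt_iff.1 ((abs_dist_sub_le (u + k • (x - u)) m u).trans_lt hx)
  have h3 : dist x u ≤ dist (u + k • (x - u)) u := by
    have : dist (u + k • (x - u)) u = k * dist x u := by
      simp [dist_eq_norm, norm_smul, abs_of_nonneg (zero_le_one.trans hk)]
    rw [this]
    exact le_mul_of_one_le_left dist_nonneg hk
  have h4 := dist_triangle y x u
  rw [abs_of_nonneg (sub_nonneg.2 h3)] at h1
  have h5 := dist_triangle4 m (u + k • (x - u)) x y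
  rw [dist_comm m (u + k • (x - u))] at h5
  rw [dist_comm y x] at h4
  linarith

/-- The corridor around an edge `e` with middle part `K`, leaving the circles around its end
vertices at the points `m`. -/
def corridor (p : V → Plane) (e : Sym2 V) (K : Set Plane) (m : V → Plane) (δ : ℝ) : Set Plane :=
  Metric.thickening δ K ∪ ⋃ u ∈ e, openCone (p u) (m u) δ

theorem isOpen_corridor (p : V → Plane) (e : Sym2 V) (K : Set Plane) (m : V → Plane) (δ : ℝ) :
    IsOpen (corridor p e K m δ) :=
  Metric.isOpen_thickening.union (isOpen_iUnion fun _ =>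
    isOpen_iUnion fun _ => isOpen_openCone _ _ _)

/-- The thickening is connected like K, and each cone is glued to it at m u. -/
theorem isPreconnected_corridor {e : Sym2 V} {K : Set Plane} {m : V → Plane}
    (hK : IsPreconnected K) (hm : ∀ u ∈ e, m u ∈ K) (hδ : 0 < δ) :
    IsPreconnected (corridor p e K m δ) := by
  have hball : ∀ z ∈ K, Metric.ball z δ ⊆ Metric.thickening δ K := fun z hz =>
    Metric.ball_subset_thickening hz δ
  have hKt : K ⊆ Metric.thickening δ K := Metric.self_subset_thickening hδ K
  have ht : IsPreconnected (Metric.thickening δ K) := by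
    refine isPreconnected_of_forall_pair fun x hx y hy => ?_
    obtain ⟨x', hx', hxx'⟩ := Metric.mem_thickening_iff.1 hx
    obtain ⟨y', hy', hyy'⟩ := Metric.mem_thickening_iff.1 hy
    refine ⟨Metric.ball x' δ ∪ K ∪ Metric.ball y' δ,
      union_subset (union_subset (hball _ hx') hKt) (hball _ hy'),
      Or.inl (Or.inl hxx'), Or.inr hyy', ?_⟩
    refine IsPreconnected.union y' (Or.inr hy') (Metric.mem_ball_self hδ) ?_
      (convex_ball _ _).isPreconnected
    exact IsPreconnected.union x' (Metric.mem_ball_self hδ) hx' (convex_ball _ _).isPreconnected hK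
  have hu := Sym2.out_fst_mem e
  refine isPreconnected_of_forall (m e.out.1) fun y hy => ?_
  rcases hy with hy | hy
  · exact ⟨_, subset_union_left, hKt (hm _ hu), hy, ht⟩
  · simp only [mem_iUnion] at hy
    obtain ⟨u, hue, hy⟩ := hy
    refine ⟨Metric.thickening δ K ∪ openCone (p u) (m u) δ,
      union_subset_union_right _ (subset_biUnion_of_mem (u := fun u => openCone (p u) (m u) δ) hue),
      Or.inl (hKt (hm _ hu)), Or.inr hy, ?_⟩
    exact IsPreconnected.union (m u) (hKt (hm u hue))
      (ball_subset_openCone _ _ _ (Metric.mem_ball_self hδ)) ht (isPreconnected_openCone _ _ hδ)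

theorem accessible_corridor {e : Sym2 V} {K : Set Plane} {m : V → Plane} {u : V} (hu : u ∈ e)
    (hδ : 0 < δ) : Accessible (corridor p e K m δ) (p u) :=
  ⟨Metric.ball (m u) δ, Metric.isOpen_ball, ⟨_, Metric.mem_ball_self hδ⟩, fun _ hc _ hy hne =>
    Or.inr (mem_biUnion hu (mem_openCone_of_mem_segment hc hy hne))⟩

end Regions

/-- The edges of a planar drawing lie in disjoint open connected sets from which their end
vertices are accessible. -/
theorem exists_regions {V : Type*} [Finite V] {G : SimpleGraph V} {p : V → Plane}
    (hp : Function.Injective p) {c : G.edgeSet → Set Plane}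
    (harc : ∀ (u v : V) (h : G.Adj u v), IsArc (c ⟨s(u, v), h⟩) (p u) (p v))
    (hmem : ∀ (e : G.edgeSet) (w : V), p w ∈ c e → w ∈ (e : Sym2 V))
    (hplanar : ∀ e f : G.edgeSet, e ≠ f → c e ∩ c f ⊆ range p) :
    ∃ U : G.edgeSet → Set Plane, (∀ e, IsOpen (U e)) ∧ (∀ e, IsPreconnected (U e)) ∧
      (∀ e w, p w ∉ U e) ∧ (∀ e : G.edgeSet, ∀ w ∈ (e : Sym2 V), Accessible (U e) (p w)) ∧
      ∀ e f, e ≠ f → Disjoint (U e) (U f) := by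
  classical
  have hcomp : ∀ e, IsCompact (c e) := by
    rintro ⟨e, he⟩
    induction e with | _ u v => exact (harc u v he).isCompact
  obtain ⟨r, hr, hr1, hr2⟩ := exists_vertex_radius hp fun e => (hcomp e).isClosed
  have hmid : ∀ e : G.edgeSet, ∃ (K : Set Plane) (m : V → Plane), IsCompact K ∧ IsPreconnected K ∧
      K ⊆ c e ∧ ∀ w ∈ (e : Sym2 V), m w ∈ K ∧ dist (m w) (p w) = r ∧ ∀ z ∈ K, r ≤ dist z (p w) := by
    rintro ⟨e, he⟩
    induction e with | _ u v =>
    have huv : u ≠ v := G.ne_of_adj he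
    obtain ⟨K, x, y, h1, h2, h3, h4, h5, h6, h7, h8⟩ :=
      (harc u v he).exists_middle hr (by linarith [hr1 u v huv])
    refine ⟨K, fun w => if w = u then x else y, h1, h2, h3, fun w hw => ?_⟩
    rcases Sym2.mem_iff.1 hw with rfl | rfl
    · simp only [if_true]; exact ⟨h4, h6, fun z hz => (h8 z hz).1⟩
    · simp only [if_neg huv.symm]; exact ⟨h5, h7, fun z hz => (h8 z hz).2⟩
  choose K m hK hKc hKsub hm using hmid
  -- Middle parts stay away from all vertices, the only possible common points of two edges, so
  -- distinct middle parts are disjoint compact sets.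
  have hKr : ∀ e w, ∀ z ∈ K e, r ≤ dist z (p w) := by
    intro e w z hz
    by_cases hw : w ∈ (e : Sym2 V)
    · exact (hm e w hw).2.2 z hz
    · linarith [hr2 e w (fun h => hw (hmem e w h)) z (hKsub e hz)]
  obtain ⟨δ, hδ, hδr, hsep⟩ := exists_separation hK (fun e f hef => by
    rw [Set.disjoint_left]
    intro z hze hzf
    obtain ⟨w, rfl⟩ := hplanar e f hef ⟨hKsub e hze, hKsub f hzf⟩
    have := hKr e w _ hze
    rw [dist_self] at this
    linarith) hr
  have hmix : ∀ e f, e ≠ f → ∀ x ∈ Metric.thickening δ (K e), ∀ u ∈ (f : Sym2 V),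
      x ∉ openCone (p u) (m f u) δ := by
    intro e f hef x hx u hu hxu
    obtain ⟨y, hy, hxy⟩ := Metric.mem_thickening_iff.1 hx
    exact notMem_openCone_of_dist (hm f u hu).2.1 (hKr e u y hy)
      (hsep f e hef.symm _ (hm f u hu).1 y hy) hxy hxu
  refine ⟨fun e => corridor p e (K e) (m e) δ, fun e => isOpen_corridor _ _ _ _ _,
    fun e => isPreconnected_corridor (hKc e) (fun u hu => (hm e u hu).1) hδ, ?_,
    fun e w hw => accessible_corridor hw hδ, ?_⟩
  · rintro e w (hw | hw)
    · obtain ⟨z, hz, hwz⟩ := Metric.mem_thickening_iff.1 hw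
      have := hKr e w z hz
      rw [dist_comm] at hwz
      linarith
    · simp only [mem_iUnion] at hw
      obtain ⟨u, hu, hw⟩ := hw
      by_cases huw : w = u
      · subst huw
        obtain ⟨k, -, hk⟩ := hw
        have := (hm e w hu).2.1
        simp only [sub_self, smul_zero, add_zero] at hk
        rw [dist_comm] at hk
        linarith
      · have := dist_lt_of_mem_openCone hw (hm e u hu).2.1
        linarith [hr1 w u huw]
  · intro e f hef
    rw [Set.disjoint_left]
    rintro x (hxe | hxe) (hxf | hxf)
    · obtain ⟨y, hy, hxy⟩ := Metric.mem_thickening_iff.1 hxe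
      obtain ⟨z, hz, hxz⟩ := Metric.mem_thickening_iff.1 hxf
      have := hsep e f hef y hy z hz
      have := dist_triangle_left y z x
      linarith
    · simp only [mem_iUnion] at hxf
      obtain ⟨u, hu, hxf⟩ := hxf
      exact hmix e f hef x hxe u hu hxf
    · simp only [mem_iUnion] at hxe
      obtain ⟨u, hu, hxe⟩ := hxe
      exact hmix f e hef.symm x hxf u hu hxe
    · simp only [mem_iUnion] at hxe hxf
      obtain ⟨u, hu, hxe⟩ := hxe
      obtain ⟨w, hw, hxf⟩ := hxf
      by_cases huw : u = w
      · subst huw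
        exact notMem_openCone hxe (hm e u hu).2.1 (hm f u hw).2.1
          (hsep e f hef _ (hm e u hu).1 _ (hm f u hw).1) hxf
      · have h1 := dist_lt_of_mem_openCone hxe (hm e u hu).2.1
        have h2 := dist_lt_of_mem_openCone hxf (hm f w hw).2.1
        have h3 := dist_triangle_left (p u) (p w) x
        have h4 := hr1 u w huw
        linarith

/-! ### Homeomorphisms of the plane moving finitely many points -/

theorem exists_continuous_interpolation {ι : Type*} [Finite ι] {x : ι → ℝ}
    (hx : Function.Injective x) (y : ι → ℝ) : ∃ f : ℝ → ℝ, Continuous f ∧ ∀ i, f (x i) = y i := by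
  classical
  have := Fintype.ofFinite ι
  exact ⟨_, (Lagrange.interpolate Finset.univ x y).continuous, fun i =>
    Lagrange.eval_interpolate_at_node y hx.injOn (Finset.mem_univ i)⟩

/-- A shear of the plane along the first axis. -/
def shear (f : ℝ → ℝ) (hf : Continuous f) : ℝ × ℝ ≃ₜ ℝ × ℝ where
  toFun z := (z.1 + f z.2, z.2)
  invFun z := (z.1 - f z.2, z.2)
  left_inv z := by simp
  right_inv z := by simp
  continuous_toFun := by fun_prop
  continuous_invFun := by fun_prop

/-- A generic w is parallel to no difference of two of the points. The extra degenerate line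
excludes w = 0 even when there are no points at all. -/
theorem exists_direction {ι : Type*} [Finite ι] {p : ι → Plane} (hp : Function.Injective p) :
    ∃ w : Plane, w ≠ 0 ∧ Function.Injective fun i => cross w (p i) := by
  obtain ⟨w, -, hw⟩ := exists_mem_not_mem_lines
    ((finite_range fun z : ι × ι => ((0 : Plane), p z.1 - p z.2)).union
      (finite_singleton ((0 : Plane), (0 : Plane)))) isOpen_univ ⟨0, mem_univ _⟩
  have hw0 : w ≠ 0 := by
    rintro rfl
    exact hw (0, 0) (Or.inr rfl) (left_mem_line _ _)
  refine ⟨w, hw0, fun i j hij => ?_⟩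
  by_contra hne
  have h0 : cross w (p i - p j) = 0 := by
    simp only [cross] at hij ⊢
    simp; linarith
  obtain ⟨t, ht⟩ := exists_smul_of_cross_eq_zero hw0 h0
  have ht0 : t ≠ 0 := by
    rintro rfl
    rw [zero_smul, sub_eq_zero] at ht
    exact hne (hp ht)
  exact hw (0, p i - p j) (Or.inl ⟨(i, j), rfl⟩) ⟨t⁻¹, by
    simp only [sub_zero, zero_add, ht, smul_smul, inv_mul_cancel₀ ht0, one_smul]⟩

/-- In coordinates where the second entries are distinct, one shear makes the first entries equal to
n. After swapping the axes, the values of n are distinct and a second shear clears the other entry.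
-/
theorem exists_homeomorph_to_axis {ι : Type*} [Finite ι] {p : ι → Plane}
    (hp : Function.Injective p) {n : ι → ℝ} (hn : Function.Injective n) :
    ∃ h : Plane ≃ₜ ℝ × ℝ, ∀ i, h (p i) = (0, n i) := by
  obtain ⟨w, hw0, hw⟩ := exists_direction hp
  have hc : cross !₂[w 1, -w 0] w ≠ 0 := by
    intro h
    simp [cross] at h
    apply hw0
    apply plane_ext <;> simp <;> nlinarith
  obtain ⟨f, hf, hfp⟩ := exists_continuous_interpolation hw
    (fun i => n i - cross !₂[w 1, -w 0] (p i))
  obtain ⟨g, hg, hgp⟩ := exists_continuous_interpolation hn (fun i => - cross w (p i))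
  refine ⟨((axesHomeomorph 0 _ w hc).trans (shear f hf)).trans
    ((Homeomorph.prodComm ℝ ℝ).trans (shear g hg)), fun i => ?_⟩
  simp [axesHomeomorph, shear, hfp, hgp]

theorem exists_homeomorph_apply_eq {ι : Type*} [Finite ι] {p q : ι → Plane}
    (hp : Function.Injective p) (hq : Function.Injective q) :
    ∃ h : Plane ≃ₜ Plane, ∀ i, h (p i) = q i := by
  obtain ⟨k, ⟨e⟩⟩ := Finite.exists_equiv_fin ι
  have hn : Function.Injective fun i => ((e i : ℕ) : ℝ) :=
    Nat.cast_injective.comp (Fin.val_injective.comp e.injective)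
  obtain ⟨h, hh⟩ := exists_homeomorph_to_axis hp hn
  obtain ⟨h', hh'⟩ := exists_homeomorph_to_axis hq hn
  refine ⟨h.trans h'.symm, fun i => ?_⟩
  rw [Homeomorph.trans_apply, hh, ← hh' i, Homeomorph.symm_apply_apply]

theorem IsArc.image {C : Set Plane} {a b : Plane} (h : IsArc C a b) (φ : Plane ≃ₜ Plane) :
    IsArc (φ '' C) (φ a) (φ b) := by
  obtain ⟨γ, hγ, rfl⟩ := h
  exact ⟨γ.map φ.continuous, φ.injective.comp hγ, (range_comp φ γ)⟩

/-! ### The complement of a polygonal forest is connected -/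

/-- In a separation of U \ S the connected collar Q lies on one side. Adding the open set Q ∪ S to
that side would separate U. -/
theorem isPreconnected_diff_of_collar {X : Type*} [TopologicalSpace X] {U S Q : Set X}
    (hU : IsPreconnected U) (hV : IsOpen (U \ S)) (hQ : IsPreconnected Q)
    (hQne : Q.Nonempty) (hQU : Q ⊆ U \ S) (hQS : IsOpen (Q ∪ S)) : IsPreconnected (U \ S) := by
  have key : ∀ A B : Set X, IsOpen A → IsOpen B → U \ S ⊆ A ∪ B → (U \ S ∩ B).Nonempty →
      (Q ∩ A).Nonempty → (U \ S ∩ (A ∩ B)).Nonempty := by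
    intro A B hA hB hAB hneB hQA
    by_contra hno
    have hno' : ∀ x ∈ U \ S, x ∈ A → x ∉ B := fun x hx hxA hxB => hno ⟨x, hx, hxA, hxB⟩
    have hQsub : Q ⊆ A := by
      intro x hx
      rcases hAB (hQU hx) with h | h
      · exact h
      · obtain ⟨y, hy, hyA, hyB⟩ := hQ A B hA hB (hQU.trans hAB) hQA ⟨x, hx, h⟩
        exact absurd hyB (hno' y (hQU hy) hyA)
    obtain ⟨q, hq, hqA⟩ := hQA
    obtain ⟨y, hyU, hy1, hyV, hyB⟩ := hU (A ∪ (Q ∪ S)) (U \ S ∩ B) (hA.union hQS) (hV.inter hB)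
      (fun x hx => by
        by_cases hxS : x ∈ S
        · exact Or.inl (Or.inr (Or.inr hxS))
        · rcases hAB ⟨hx, hxS⟩ with h | h
          · exact Or.inl (Or.inl h)
          · exact Or.inr ⟨⟨hx, hxS⟩, h⟩)
      ⟨q, (hQU hq).1, Or.inl hqA⟩ (by
        obtain ⟨x, hx, hxB⟩ := hneB
        exact ⟨x, hx.1, hx, hxB⟩)
    rcases hy1 with h | h | h
    · exact hno' y hyV h hyB
    · exact hno' y hyV (hQsub h) hyB
    · exact hyV.2 h
  intro A B hA hB hAB hneA hneB
  obtain ⟨q, hq⟩ := hQne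
  rcases hAB (hQU hq) with h | h
  · exact key A B hA hB hAB hneB ⟨q, hq, h⟩
  · rw [inter_comm A B]
    exact key B A hB hA (by rwa [union_comm]) hneA ⟨q, hq, h⟩

theorem isPreconnected_strip {ρ : ℝ} {h : ℝ → ℝ} (hh : Continuous h) (σ : ℝ) :
    IsPreconnected ((fun z : ℝ × ℝ => (z.1, σ * z.2 * h z.1)) '' (Ioo 0 ρ ×ˢ Ioo 0 1)) :=
  (((convex_Ioo _ _).prod (convex_Ioo _ _)).isPreconnected).image _ (by fun_prop)

/-- Attaching the unit segment to a closed set at the origin does not disconnect the complement. -/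
theorem isPreconnected_compl_union_unit_segment {K : Set (ℝ × ℝ)} (hK : IsClosed K)
    (hKc : IsPreconnected Kᶜ) (h0 : ((0, 0) : ℝ × ℝ) ∈ K)
    (h1 : ∀ t : ℝ, 0 < t → t ≤ 1 → (t, (0 : ℝ)) ∉ K) :
    IsPreconnected (K ∪ Icc 0 1 ×ˢ {0})ᶜ := by
  -- The collar follows the segment with half-width its distance to K. Freezing this distance beyond
  -- the end makes the part past 1 a rectangular cap, which joins the strips on the two sides.
  let h : ℝ → ℝ := fun t => Metric.infDist (min t 1, (0 : ℝ)) K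
  have hh : Continuous h := (Metric.continuous_infDist_pt K).comp (by fun_prop)
  have hpos : ∀ t, 0 < t → 0 < h t := fun t ht =>
    (hK.notMem_iff_infDist_pos ⟨_, h0⟩).1 (h1 _ (lt_min ht one_pos) (min_le_right _ _))
  let ρ : ℝ := 1 + h 1
  have hρ : 1 < ρ := by have := hpos 1 one_pos; simp only [ρ]; linarith
  let S : Set (ℝ × ℝ) := Ioc 0 1 ×ˢ {0}
  let R : Set (ℝ × ℝ) := {z | 0 < z.1 ∧ z.1 < ρ ∧ |z.2| < h z.1}
  have hRo : IsOpen R := (isOpen_lt continuous_const continuous_fst).inter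
    ((isOpen_lt continuous_fst continuous_const).inter
      (isOpen_lt continuous_snd.abs (hh.comp continuous_fst)))
  have hRK : R ⊆ Kᶜ := by
    rintro ⟨t, s⟩ ⟨ht0, htρ, hs⟩ hmem
    have h2 := Metric.infDist_le_dist_of_mem (x := (min t 1, (0 : ℝ))) hmem
    have h3 : dist (min t 1, (0 : ℝ)) (t, s) < h t := by
      rw [Prod.dist_eq, max_lt_iff]
      refine ⟨?_, by simpa [Real.dist_eq] using hs⟩
      rcases le_total t 1 with ht1 | ht1
      · simpa [ht1] using hpos t ht0
      · have e : h t = h 1 := by simp [h, ht1]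
        rw [e]
        simp only [ρ] at htρ
        rw [min_eq_right ht1, Real.dist_eq, abs_sub_comm, abs_of_nonneg (by linarith)]
        linarith
    exact absurd h2 (not_le.2 h3)
  have hSR : S ⊆ R := by
    rintro ⟨t, s⟩ ⟨⟨ht0, ht1⟩, hs⟩
    obtain rfl : s = 0 := hs
    exact ⟨ht0, ht1.trans_lt hρ, by simpa using hpos t ht0⟩
  have hcompl : (K ∪ Icc 0 1 ×ˢ {0})ᶜ = Kᶜ \ S := by
    ext ⟨t, s⟩
    simp only [mem_compl_iff, mem_union, not_or, mem_sdiff, S, mem_prod, mem_Icc, mem_Ioc,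
      mem_singleton_iff, and_congr_right_iff]
    intro hts
    refine not_congr ⟨fun h => ⟨⟨h.1.1.lt_of_ne ?_, h.1.2⟩, h.2⟩, fun h => ⟨⟨h.1.1.le, h.1.2⟩, h.2⟩⟩
    rintro rfl
    rw [h.2] at hts
    exact hts h0
  have hRS : R \ S = (fun z : ℝ × ℝ => (z.1, 1 * z.2 * h z.1)) '' (Ioo 0 ρ ×ˢ Ioo 0 1) ∪
      Ioo 1 ρ ×ˢ Ioo (-h 1) (h 1) ∪
      (fun z : ℝ × ℝ => (z.1, -1 * z.2 * h z.1)) '' (Ioo 0 ρ ×ˢ Ioo 0 1) := by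
    have hge : ∀ t, 1 ≤ t → h t = h 1 := fun t ht => by simp [h, ht]
    ext ⟨t, s⟩
    constructor
    · rintro ⟨⟨ht0, htρ, hs⟩, hS⟩
      have hp := hpos t ht0
      simp only at ht0 htρ hs
      rcases lt_trichotomy s 0 with h2 | h2 | h2
      · rw [abs_of_neg h2] at hs
        exact Or.inr ⟨(t, -s / h t), ⟨⟨ht0, htρ⟩, by simp only; exact div_pos (by linarith) hp,
          (div_lt_one hp).2 hs⟩, by simp only; congr 1; field_simp⟩
      · subst h2
        have : 1 < t := by
          by_contra! ht1
          exact hS ⟨⟨ht0, ht1⟩, rfl⟩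
        have := hpos 1 one_pos
        exact Or.inl (Or.inr ⟨⟨‹1 < t›, htρ⟩, by simp only; linarith, this⟩)
      · rw [abs_of_pos h2] at hs
        exact Or.inl (Or.inl ⟨(t, s / h t), ⟨⟨ht0, htρ⟩, div_pos h2 hp,
          (div_lt_one hp).2 hs⟩, by simp only; congr 1; field_simp⟩)
    · rintro ((⟨⟨t', r⟩, ⟨⟨ht0, htρ⟩, hr0, hr1⟩, heq⟩ | ⟨⟨ht1, htρ⟩, hs⟩) |
        ⟨⟨t', r⟩, ⟨⟨ht0, htρ⟩, hr0, hr1⟩, heq⟩)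
      · simp only [Prod.mk.injEq] at heq ht0 htρ hr0 hr1
        obtain ⟨rfl, rfl⟩ := heq
        have hp := hpos t' ht0
        have h2 : 0 < 1 * r * h t' := by positivity
        refine ⟨⟨ht0, htρ, ?_⟩, fun hS => h2.ne' hS.2⟩
        simp only [abs_of_pos h2]
        nlinarith
      · simp only at ht1 htρ hs
        refine ⟨⟨by simp only; linarith, htρ, ?_⟩, fun hS => absurd hS.1.2 (not_le.2 ht1)⟩
        rw [hge _ (show 1 ≤ t by linarith)]
        exact abs_lt.2 hs
      · simp only [Prod.mk.injEq] at heq ht0 htρ hr0 hr1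
        obtain ⟨rfl, rfl⟩ := heq
        have hp := hpos t' ht0
        have h2 : -1 * r * h t' < 0 := by nlinarith [mul_pos hr0 hp]
        refine ⟨⟨ht0, htρ, ?_⟩, fun hS => h2.ne hS.2⟩
        simp only [abs_of_neg h2]
        nlinarith
  have hmid : (1 + ρ) / 2 ∈ Ioo 1 ρ := ⟨by linarith, by linarith⟩
  have hmid0 : (1 + ρ) / 2 ∈ Ioo 0 ρ := ⟨by linarith, by linarith⟩
  have hhm : h ((1 + ρ) / 2) = h 1 := by
    have : (1 : ℝ) ≤ (1 + ρ) / 2 := by linarith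
    simp [h, this]
  have hhalf : (1 / 2 : ℝ) ∈ Ioo (0 : ℝ) 1 := ⟨by norm_num, by norm_num⟩
  have hp1 := hpos 1 one_pos
  have hconn : IsPreconnected (R \ S) := by
    rw [hRS]
    refine IsPreconnected.union ((1 + ρ) / 2, -(1 / 2) * h 1) (Or.inr ⟨hmid, ?_⟩)
      ⟨((1 + ρ) / 2, 1 / 2), ⟨hmid0, hhalf⟩, by simp only [hhm]; congr 1; ring⟩
      (IsPreconnected.union ((1 + ρ) / 2, 1 / 2 * h 1)
        ⟨((1 + ρ) / 2, 1 / 2), ⟨hmid0, hhalf⟩, by simp only [hhm]; congr 1; ring⟩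
        ⟨hmid, ?_⟩ (isPreconnected_strip hh 1)
        ((convex_Ioo _ _).prod (convex_Ioo _ _)).isPreconnected) (isPreconnected_strip hh (-1))
    · constructor <;> simp only <;> linarith
    · constructor <;> simp only <;> linarith
  have hne : (R \ S).Nonempty := by
    refine ⟨((1 + ρ) / 2, 0), ⟨hmid0.1, hmid0.2, ?_⟩, fun hS => absurd hS.1.2 (not_le.2 hmid.1)⟩
    simp only [hhm, abs_zero]; exact hp1
  rw [hcompl]
  refine isPreconnected_diff_of_collar hKc ?_ hconn hne
    (sdiff_subset_sdiff_left hRK) (by rwa [sdiff_union_of_subset hSR])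
  rw [← hcompl]
  exact (hK.union (isClosed_Icc.prod isClosed_singleton)).isOpen_compl

theorem isPreconnected_compl_union_segment {K : Set Plane} (hK : IsClosed K)
    (hKc : IsPreconnected Kᶜ) {b c : Plane} (hbc : b ≠ c) (hb : b ∈ K)
    (hint : segment ℝ b c ∩ K ⊆ {b}) : IsPreconnected (K ∪ segment ℝ b c)ᶜ := by
  let v : Plane := c - b
  let w : Plane := !₂[-(v 1), v 0]
  have hd : 0 < cross v w := by
    have hv : v ≠ 0 := sub_ne_zero.2 hbc.symm
    have : ¬ (v 0 = 0 ∧ v 1 = 0) := fun h => hv (plane_ext (by simpa using h.1) (by simpa using h.2))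
    simp only [cross, w, Matrix.cons_val_zero, Matrix.cons_val_one,
      Matrix.cons_val_fin_one]
    by_contra! hle
    have h0 := mul_self_nonneg (v 0)
    have h1 := mul_self_nonneg (v 1)
    exact this ⟨mul_self_eq_zero.1 (by linarith), mul_self_eq_zero.1 (by linarith)⟩
  have hd' : cross w v = - cross v w := by simp only [cross]; ring
  have hwv : cross w ((cross w v)⁻¹ • v) = 1 := by
    have : cross w ((cross w v)⁻¹ • v) = (cross w v)⁻¹ * cross w v := by simp [cross]; ring
    rw [this, inv_mul_cancel₀ (by rw [hd']; exact (neg_neg_of_pos hd).ne)]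
  -- coordinates in which the segment is the unit segment on the first axis
  let ψ : ℝ × ℝ ≃ₜ Plane := (axesHomeomorph b ((cross w v)⁻¹ • w) v (by
    have : cross ((cross w v)⁻¹ • w) v = (cross w v)⁻¹ * cross w v := by simp [cross]; ring
    rw [this, inv_mul_cancel₀ (by rw [hd']; exact (neg_neg_of_pos hd).ne)]
    exact one_ne_zero)).symm
  have hψ : ∀ t : ℝ, ψ.symm (b + t • (c - b)) = (t, 0) := by
    intro t
    have e1 : cross ((cross w v)⁻¹ • w) (t • v) = t * ((cross w v)⁻¹ * cross w v) := by
      simp [cross]; ring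
    have e2 : cross v (t • v) = 0 := cross_smul_self v t
    simp only [ψ, Homeomorph.symm_symm]
    change (cross ((cross w v)⁻¹ • w) (b + t • v - b), cross v (b + t • v - b)) = (t, 0)
    rw [add_sub_cancel_left, e1, e2, inv_mul_cancel₀ (by rw [hd']; exact (neg_neg_of_pos hd).ne),
      mul_one]
  have hψ' : ∀ t : ℝ, ψ (t, 0) = b + t • (c - b) := fun t => by
    rw [← hψ t, Homeomorph.apply_symm_apply]
  have hb0 : ψ (0, 0) = b := by rw [hψ']; simp
  have hseg : ψ ⁻¹' segment ℝ b c = Icc 0 1 ×ˢ {0} := by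
    ext ⟨t, s⟩
    rw [mem_preimage, mem_segment_iff_exists]
    constructor
    · rintro ⟨r, hr0, hr1, hr⟩
      rw [← hψ'] at hr
      obtain ⟨rfl, rfl⟩ := Prod.mk.inj (ψ.injective hr)
      exact ⟨⟨hr0, hr1⟩, rfl⟩
    · rintro ⟨⟨h0, h1⟩, hs⟩
      obtain rfl : s = 0 := hs
      exact ⟨t, h0, h1, hψ' t⟩
  have hpre := isPreconnected_compl_union_unit_segment (hK.preimage ψ.continuous)
    (by rw [← preimage_compl]; exact ψ.isPreconnected_preimage.2 hKc) (by rwa [mem_preimage, hb0])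
    (fun t ht0 ht1 hmem => by
      have h2 : b + t • (c - b) = b :=
        hint ⟨mem_segment_iff_exists.2 ⟨t, ht0.le, ht1, rfl⟩, by rw [← hψ']; exact hmem⟩
      have h3 : ψ (t, 0) = ψ (0, 0) := by rw [hψ', h2, hb0]
      exact ht0.ne' (congrArg Prod.fst (ψ.injective h3)))
  rw [← hseg, ← preimage_union, ← preimage_compl] at hpre
  exact ψ.isPreconnected_preimage.1 hpre

/-- The collar is a punctured ball, homeomorphic to the punctured plane. -/
theorem isPreconnected_diff_singleton {U : Set Plane} (hU : IsOpen U) (hUc : IsPreconnected U)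
    (x : Plane) : IsPreconnected (U \ {x}) := by
  by_cases hx : x ∈ U
  · obtain ⟨ε, hε, hb⟩ := Metric.isOpen_iff.1 hU x hx
    have hconn : IsConnected (Metric.ball x ε \ {x}) := by
      have hrank : 1 < Module.rank ℝ Plane := by
        rw [← Module.finrank_eq_rank, finrank_euclideanSpace_fin]; norm_num
      let φ := OpenPartialHomeomorph.univBall x ε
      have hinj : Function.Injective φ := by
        have := φ.injOn
        rwa [OpenPartialHomeomorph.univBall_source, injOn_univ] at this
      have himg : φ '' {0}ᶜ = Metric.ball x ε \ {x} := by
        rw [compl_eq_univ_sdiff, image_sdiff hinj, image_singleton,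
          OpenPartialHomeomorph.univBall_apply_zero,
          ← OpenPartialHomeomorph.univBall_target x hε, ← φ.image_source_eq_target,
          OpenPartialHomeomorph.univBall_source]
      rw [← himg]
      exact (isConnected_compl_singleton_of_one_lt_rank hrank 0).image _
        (OpenPartialHomeomorph.continuous_univBall x ε).continuousOn
    refine isPreconnected_diff_of_collar hUc (hU.sdiff isClosed_singleton)
      hconn.isPreconnected hconn.nonempty (sdiff_subset_sdiff_left hb) ?_
    · rw [sdiff_union_of_subset (singleton_subset_iff.2 (Metric.mem_ball_self hε))]
      exact Metric.isOpen_ball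
  · rwa [sdiff_singleton_eq_self hx]

theorem isPreconnected_diff_finite {U F : Set Plane} (hU : IsOpen U) (hUc : IsPreconnected U)
    (hF : F.Finite) : IsPreconnected (U \ F) := by
  induction F, hF using Set.Finite.induction_on with
  | empty => simpa using hUc
  | @insert x F _ hF ih =>
    rw [insert_eq, union_comm, ← sdiff_sdiff]
    exact isPreconnected_diff_singleton (hU.sdiff hF.isClosed) ih x

/-- Attaching a polygonal arc to a closed set at its starting point does not disconnect the
complement. -/
theorem PolyArc.isPreconnected_compl_union {L C N K : Set Plane} {a b : Plane}
    (h : PolyArc L a C b N) (hK : IsClosed K) (hKc : IsPreconnected Kᶜ) (hint : C ∩ K ⊆ {a}) :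
    IsPreconnected (K ∪ C)ᶜ := by
  -- The arc need not touch K; adding its start first lets every segment be attached at a point
  -- already present.
  have hKa : IsPreconnected (K ∪ {a})ᶜ := by
    rw [compl_union, ← sdiff_eq]
    exact isPreconnected_diff_singleton hK.isOpen_compl hKc a
  induction h with
  | @segment b hab _ =>
    have h2 := isPreconnected_compl_union_segment (hK.union isClosed_singleton) hKa hab
      (Or.inr rfl) (by
        rintro q ⟨hq, hq' | hq'⟩
        · exact hint ⟨hq, hq'⟩
        · exact hq')
    rwa [union_assoc, union_eq_self_of_subset_left
      (singleton_subset_iff.2 (left_mem_segment ℝ a b))] at h2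
  | @snoc C b c N h hbc _ hC ih =>
    have h2 := ih ((inter_subset_inter_left _ subset_union_left).trans hint)
    rw [← union_assoc]
    refine isPreconnected_compl_union_segment (hK.union h.isClosed) h2 hbc
      (Or.inr h.isArc.right_mem) ?_
    rintro q ⟨hq, hq' | hq'⟩
    · have hqa : q = a := hint ⟨Or.inr hq, hq'⟩
      subst hqa
      exact hC ⟨hq, h.isArc.left_mem⟩
    · exact hC ⟨hq, hq'⟩

/-! ### Drawings of graphs by generic polygonal arcs -/

section Drawings

variable {V : Type*}

/-- Every nonempty set of edges of a tree has an edge with an end vertex on no other edge. -/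
theorem exists_leaf_edge {T : SimpleGraph V} (hT : T.IsTree) {S : Set (Sym2 V)} (hS : S.Finite)
    (hne : S.Nonempty) (hST : S ⊆ T.edgeSet) :
    ∃ u v, s(u, v) ∈ S ∧ ∀ f ∈ S, v ∈ f → f = s(u, v) := by
  obtain ⟨r⟩ := hT.connected.nonempty
  have hfin : {v | ∃ e ∈ S, v ∈ e}.Finite := by
    have : {v | ∃ e ∈ S, v ∈ e} = ⋃ e ∈ S, {v | v ∈ e} := by ext; simp
    rw [this]
    refine hS.biUnion fun e _ => ?_
    induction e with | _ x y =>
    exact (Set.toFinite {x, y}).subset fun v hv => by simpa using hv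
  have hne' : {v | ∃ e ∈ S, v ∈ e}.Nonempty := by
    obtain ⟨e, he⟩ := hne
    exact ⟨e.out.1, e, he, Sym2.out_fst_mem e⟩
  obtain ⟨v, ⟨e, he, hve⟩, hmax⟩ := hfin.exists_maximalFor (T.dist r) _ hne'
  have hmax' : ∀ w, (∃ e ∈ S, w ∈ e) → T.dist r w ≤ T.dist r v := fun w hw =>
    (le_total _ _).elim id fun h => hmax hw h
  -- the neighbour of `v` along an edge of `S` is the last vertex before `v` on the path from `r`
  have key : ∀ u, s(u, v) ∈ S → ∀ q : T.Walk r v, q.IsPath → u = q.penultimate := by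
    intro u hu q hq
    -- As v is farthest from the root among the vertices on S, a shortest path to u avoids v, and
    -- appending v gives the unique path to v.
    have hadj : T.Adj u v := hST hu
    have hle := hmax' u ⟨_, hu, by simp⟩
    obtain ⟨p, hp, hlen⟩ := (hT.connected.preconnected r u).exists_path_of_dist
    have hv : v ∉ p.support := by
      intro hv
      classical
      have h1 := SimpleGraph.dist_le (p.takeUntil v hv)
      have h2 := p.length_takeUntil_le_length hv
      have h3 : T.dist r u ≠ T.dist r v := hT.dist_ne_of_adj r hadj
      omega
    have hpath : (p.concat hadj).IsPath := hp.concat hv hadj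
    have := congrArg Subtype.val ((hT.isAcyclic.subsingleton_path r v).elim ⟨q, hq⟩ ⟨_, hpath⟩)
    simp only at this
    rw [this]
    simp
  obtain ⟨q, hq⟩ := (hT.existsUnique_path r v).exists
  have hform : ∀ f ∈ S, v ∈ f → f = s(q.penultimate, v) := by
    intro f hf hvf
    obtain ⟨u, rfl⟩ := hvf
    rw [Sym2.eq_swap] at hf ⊢
    rw [← key u hf q hq]
  exact ⟨q.penultimate, v, hform e he hve ▸ he, hform⟩

/-- Curves for the edges in `S` which are generic with respect to `M` and do not cross. -/
structure IsGenericSystem (M : Set Plane) (p : V → Plane) (S : Set (Sym2 V))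
    (c : Sym2 V → Set Plane) : Prop where
  arc : ∀ e ∈ S, ∃ u v N, e = s(u, v) ∧ IsGenericArc M (c e) (p u) (p v) N
  disjoint : ∀ e ∈ S, ∀ f ∈ S, e ≠ f → c e ∩ c f ⊆ range p

namespace IsGenericSystem

variable {M : Set Plane} {p : V → Plane} {S : Set (Sym2 V)} {c : Sym2 V → Set Plane}

theorem mono (h : IsGenericSystem M p S c) {S' : Set (Sym2 V)} (hS : S' ⊆ S) :
    IsGenericSystem M p S' c :=
  ⟨fun e he => h.arc e (hS he), fun e he f hf => h.disjoint e (hS he) f (hS hf)⟩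

theorem congr (h : IsGenericSystem M p S c) {c' : Sym2 V → Set Plane}
    (hc : ∀ e ∈ S, c' e = c e) : IsGenericSystem M p S c' :=
  ⟨fun e he => by rw [hc e he]; exact h.arc e he,
    fun e he f hf => by rw [hc e he, hc f hf]; exact h.disjoint e he f hf⟩

theorem mem_of_pos_mem (h : IsGenericSystem M p S c) (hp : Function.Injective p)
    (hM : range p ⊆ M) {e : Sym2 V} (he : e ∈ S) {w : V} (hw : p w ∈ c e) : w ∈ e := by
  obtain ⟨u, v, N, rfl, harc⟩ := h.arc e he
  rcases harc.avoid ⟨hw, hM ⟨w, rfl⟩⟩ with h | h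
  · simp [hp h]
  · simp [hp (mem_singleton_iff.1 h)]

theorem isArc (h : IsGenericSystem M p S c) {u v : V} (he : s(u, v) ∈ S) :
    IsArc (c s(u, v)) (p u) (p v) := by
  obtain ⟨u', v', N, heq, harc⟩ := h.arc _ he
  rcases Sym2.eq_iff.1 heq with ⟨rfl, rfl⟩ | ⟨rfl, rfl⟩
  · exact harc.arc.isArc
  · exact harc.arc.isArc.symm

theorem exists_polyArc (h : IsGenericSystem M p S c) {u v : V} (he : s(u, v) ∈ S) :
    ∃ N, PolyArc (spanLines M) (p u) (c s(u, v)) (p v) N := by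
  obtain ⟨u', v', N, heq, harc⟩ := h.arc _ he
  rcases Sym2.eq_iff.1 heq with ⟨rfl, rfl⟩ | ⟨rfl, rfl⟩
  · exact ⟨N, harc.arc⟩
  · exact ⟨N, harc.arc.symm⟩

theorem isClosed (h : IsGenericSystem M p S c) {e : Sym2 V} (he : e ∈ S) : IsClosed (c e) := by
  obtain ⟨u, v, N, -, harc⟩ := h.arc e he
  exact harc.arc.isClosed

theorem finite_inter_spanLines (h : IsGenericSystem M p S c) (hM : M.Finite) {e : Sym2 V}
    (he : e ∈ S) : (c e ∩ spanLines M).Finite := by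
  obtain ⟨u, v, N, -, harc⟩ := h.arc e he
  exact harc.arc.finite_inter_spanLines hM

/-- The curves representing a forest have connected complement. -/
theorem isPreconnected_compl (h : IsGenericSystem M p S c) (hp : Function.Injective p)
    (hM : range p ⊆ M) {T : SimpleGraph V} (hT : T.IsTree) (hS : S.Finite)
    (hST : S ⊆ T.edgeSet) : IsPreconnected (⋃ e ∈ S, c e)ᶜ := by
  induction hn : S.ncard generalizing S with
  | zero =>
    rw [(ncard_eq_zero hS).1 hn]
    simpa using isPreconnected_univ
  | succ n ih =>
    obtain ⟨u, v, he, hleaf⟩ := exists_leaf_edge hT hS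
      (nonempty_of_ncard_ne_zero (by omega)) hST
    have hsub : S \ {s(u, v)} ⊆ S := sdiff_subset
    have h1 := ih (h.mono hsub) (hS.subset hsub) (hsub.trans hST)
      (by rw [ncard_sdiff_singleton_of_mem he]; omega)
    have heq : ⋃ e ∈ S, c e = (⋃ e ∈ S \ {s(u, v)}, c e) ∪ c s(u, v) := by
      conv_lhs => rw [← insert_sdiff_self_of_mem he]
      rw [biUnion_insert, union_comm]
    obtain ⟨N, harc⟩ := h.exists_polyArc he
    rw [heq]
    -- The leaf edge is attached from its inner end u: no other curve reaches v, so only p u can be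
    -- shared.
    refine harc.isPreconnected_compl_union
      ((hS.subset hsub).isClosed_biUnion fun f hf => h.isClosed (hsub hf)) h1 ?_
    rintro x ⟨hxe, hx⟩
    simp only [mem_iUnion] at hx
    obtain ⟨f, ⟨hfS, hfe⟩, hxf⟩ := hx
    obtain ⟨w, rfl⟩ := h.disjoint _ he f hfS (Ne.symm hfe) ⟨hxe, hxf⟩
    have hwf := h.mem_of_pos_mem hp hM hfS hxf
    rcases Sym2.mem_iff.1 (h.mem_of_pos_mem hp hM he hxe) with rfl | rfl
    · rfl
    · exact absurd (hleaf f hfS hwf) hfe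

end IsGenericSystem

/-- Close to u only segments through u matter, and a ray from u off their lines meets them nowhere
else. The point u may lie on the drawing. -/
theorem accessible_compl_segments {F : Set (Plane × Plane)} (hF : F.Finite) (u : Plane) :
    Accessible (⋃ z ∈ F, segment ℝ z.1 z.2)ᶜ u := by
  let F₀ := {z ∈ F | u ∈ segment ℝ z.1 z.2}
  let F₁ := {z ∈ F | u ∉ segment ℝ z.1 z.2}
  have hF₁ : IsClosed (⋃ z ∈ F₁, segment ℝ z.1 z.2) :=
    (hF.subset (sep_subset _ _)).isClosed_biUnion fun z _ => isClosed_segment _ _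
  have hF₀ : IsClosed (⋃ z ∈ F₀, line z.1 z.2) :=
    (hF.subset (sep_subset _ _)).isClosed_biUnion fun z _ => isClosed_line _ _
  obtain ⟨ε, hε, hball⟩ := Metric.isOpen_iff.1 hF₁.isOpen_compl u (by
    simp only [mem_compl_iff, mem_iUnion, not_exists]
    exact fun z hz h => hz.2 h)
  obtain ⟨c, hc, hcF⟩ := exists_mem_not_mem_lines (hF.subset (sep_subset _ _) : F₀.Finite)
    Metric.isOpen_ball ⟨u, Metric.mem_ball_self hε⟩
  refine ⟨Metric.ball u ε ∩ (⋃ z ∈ F₀, line z.1 z.2)ᶜ, Metric.isOpen_ball.inter hF₀.isOpen_compl,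
    ⟨c, hc, by simpa only [mem_compl_iff, mem_iUnion, not_exists] using hcF⟩, ?_⟩
  rintro d ⟨hdb, hdF⟩ y hy hyu hyK
  simp only [mem_iUnion] at hyK
  obtain ⟨z, hz, hyz⟩ := hyK
  by_cases huz : u ∈ segment ℝ z.1 z.2
  · apply hdF
    obtain ⟨s, hs⟩ := segment_subset_line huz
    obtain ⟨t, ht⟩ := segment_subset_line hyz
    obtain ⟨r, hr⟩ := mem_line_of_mem_segment hy hyu
    refine mem_biUnion (show z ∈ F₀ from ⟨hz, huz⟩) ⟨s + r * (t - s), ?_⟩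
    rw [hr, ht, hs]; module
  · have hyb := (convex_ball u ε).segment_subset (Metric.mem_ball_self hε) hdb hy
    exact hball hyb (mem_biUnion (show z ∈ F₁ from ⟨hz, huz⟩) hyz)

namespace IsGenericSystem

variable {M : Set Plane} {p : V → Plane} {S : Set (Sym2 V)} {c : Sym2 V → Set Plane}

theorem exists_eq_biUnion_segment [Finite V] (h : IsGenericSystem M p S c) (hS : S.Finite) :
    ∃ F : Set (Plane × Plane), F.Finite ∧
      (⋃ e ∈ S, c e) ∪ range p = ⋃ z ∈ F, segment ℝ z.1 z.2 := by
  have h1 : ∀ e : S, ∃ F : Set (Plane × Plane), F.Finite ∧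
      c e = ⋃ z ∈ F, segment ℝ z.1 z.2 := by
    rintro ⟨e, he⟩
    obtain ⟨u, v, N, -, harc⟩ := h.arc e he
    exact harc.arc.exists_eq_biUnion
  choose F hF hcF using h1
  have := hS.to_subtype
  refine ⟨(⋃ e, F e) ∪ range fun v => (p v, p v), (finite_iUnion hF).union (finite_range _), ?_⟩
  rw [biUnion_union, biUnion_range, biUnion_iUnion, biUnion_eq_iUnion]
  congr 1
  · exact iUnion_congr hcF
  · ext; simp [eq_comm]

/-- A generic drawing of part of a tree can be extended by a further edge of the tree. -/
theorem exists_insert [Finite V] (h : IsGenericSystem M p S c) (hp : Function.Injective p)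
    (hM : M.Finite) (hpM : range p ⊆ M) {T : SimpleGraph V} (hT : T.IsTree)
    (hST : S ⊆ T.edgeSet) {e : Sym2 V} (he : e ∈ T.edgeSet) (heS : e ∉ S) :
    ∃ c', (∀ f ∈ S, c' f = c f) ∧ IsGenericSystem M p (insert e S) c' := by
  classical
  have hS : S.Finite := Set.toFinite S
  induction e with | _ u v =>
  have huv : p u ≠ p v := hp.ne (T.ne_of_adj he)
  obtain ⟨F, hF, hK⟩ := h.exists_eq_biUnion_segment hS
  have hclosed : IsClosed (⋃ e ∈ S, c e) := hS.isClosed_biUnion fun f hf => h.isClosed hf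
  -- All vertices are removed too, so that the target v lies outside the region, as the arc
  -- construction requires.
  have hconn : IsPreconnected ((⋃ e ∈ S, c e) ∪ range p)ᶜ := by
    rw [compl_union, ← sdiff_eq]
    exact isPreconnected_diff_finite hclosed.isOpen_compl
      (h.isPreconnected_compl hp hpM hT hS hST) (finite_range p)
  have hacc : ∀ w, Accessible ((⋃ e ∈ S, c e) ∪ range p)ᶜ (p w) := fun w => by
    rw [hK]; exact accessible_compl_segments hF _
  obtain ⟨C, N, hC, hsub⟩ := exists_isGenericArc hM huv (hpM ⟨u, rfl⟩) (hpM ⟨v, rfl⟩)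
    (hclosed.union (finite_range p).isClosed).isOpen_compl hconn
    (fun h => h (Or.inr ⟨v, rfl⟩)) (hacc u) (hacc v)
  have hne : ∀ f ∈ S, f ≠ s(u, v) := fun f hf hfe => heS (hfe ▸ hf)
  have hupd : ∀ f ∈ S, Function.update c s(u, v) C f = c f := fun f hf =>
    Function.update_of_ne (hne f hf) _ _
  have hinter : ∀ f ∈ S, C ∩ c f ⊆ range p := by
    rintro f hf x ⟨hxC, hxf⟩
    rcases hsub hxC with hx | rfl | rfl
    · exact absurd (Or.inl (mem_biUnion hf hxf)) hx
    · exact ⟨u, rfl⟩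
    · exact ⟨v, rfl⟩
  refine ⟨Function.update c s(u, v) C, hupd, ?_, ?_⟩
  · rintro f (rfl | hf)
    · exact ⟨u, v, N, rfl, by rwa [Function.update_self]⟩
    · rw [hupd f hf]; exact h.arc f hf
  · rintro f (rfl | hf) g (rfl | hg) hfg
    · exact absurd rfl hfg
    · rw [Function.update_self, hupd g hg]; exact hinter g hg
    · rw [Function.update_self, hupd f hf, inter_comm]; exact hinter f hf
    · rw [hupd f hf, hupd g hg]; exact h.disjoint f hf g hg hfg

theorem exists_union [Finite V] (h : IsGenericSystem M p S c) (hp : Function.Injective p)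
    (hM : M.Finite) (hpM : range p ⊆ M) {T : SimpleGraph V} (hT : T.IsTree)
    (hST : S ⊆ T.edgeSet) {D : Set (Sym2 V)} (hD : D ⊆ T.edgeSet) (hSD : Disjoint S D) :
    ∃ c', (∀ f ∈ S, c' f = c f) ∧ IsGenericSystem M p (S ∪ D) c' := by
  have hDfin : D.Finite := Set.toFinite D
  induction D, hDfin using Set.Finite.induction_on with
  | empty => exact ⟨c, fun _ _ => rfl, by simpa using h⟩
  | @insert e D heD _ ih =>
    rw [disjoint_insert_right] at hSD
    obtain ⟨heT, hDT⟩ := insert_subset_iff.1 hD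
    obtain ⟨c₁, hc₁, h₁⟩ := ih hDT hSD.2
    obtain ⟨c₂, hc₂, h₂⟩ := h₁.exists_insert hp hM hpM hT (union_subset hST hDT) heT
      (fun h => h.elim hSD.1 heD)
    refine ⟨c₂, fun f hf => (hc₂ f (Or.inl hf)).trans (hc₁ f hf), ?_⟩
    rwa [union_insert]

end IsGenericSystem

/-- A planar graph has a polygonal planar drawing with prescribed positions of the vertices, in
general position with respect to a given finite set. -/
theorem exists_isGenericSystem_of_isPlanarGraph [Finite V] {G : SimpleGraph V}
    (hG : IsPlanarGraph G) {p : V → Plane} (hp : Function.Injective p) {M : Set Plane}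
    (hM : M.Finite) (hpM : range p ⊆ M) : ∃ c, IsGenericSystem M p G.edgeSet c := by
  classical
  obtain ⟨Γ, hΓ⟩ := hG
  obtain ⟨φ, hφ⟩ := exists_homeomorph_apply_eq Γ.pos_injective hp
  obtain ⟨U, hUo, hUc, hUp, hUacc, hUdisj⟩ := exists_regions hp
    (c := fun e => φ '' Γ.curve e)
    (fun u v h => by rw [← hφ, ← hφ]; exact (Γ.isArc u v h).image φ)
    (fun e w hw => by
      obtain ⟨x, hx, hxw⟩ := hw
      rw [← hφ] at hxw
      exact Γ.mem_of_pos_mem e w (φ.injective hxw ▸ hx))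
    (by
      rintro e f hef _ ⟨⟨x, hxe, rfl⟩, y, hyf, hxy⟩
      obtain rfl := φ.injective hxy
      by_contra hx
      have hx' : y ∉ range Γ.pos := by
        rintro ⟨w, rfl⟩
        exact hx ⟨w, (hφ w).symm⟩
      exact hΓ e f ⟨hef, y, ⟨hxe, hx'⟩, hyf, hx'⟩)
  have hex : ∀ e : G.edgeSet, ∃ C u v N, (e : Sym2 V) = s(u, v) ∧
      IsGenericArc M C (p u) (p v) N ∧ C ⊆ U e ∪ range p := by
    rintro ⟨e, he⟩
    induction e with | _ u v =>
    obtain ⟨C, N, hC, hsub⟩ := exists_isGenericArc hM (hp.ne (G.ne_of_adj he)) (hpM ⟨u, rfl⟩)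
      (hpM ⟨v, rfl⟩) (hUo ⟨s(u, v), he⟩) (hUc _) (hUp _ v) (hUacc _ u (by simp))
      (hUacc _ v (by simp))
    refine ⟨C, u, v, N, rfl, hC, hsub.trans (union_subset_union_right _ ?_)⟩
    rintro x (rfl | rfl)
    exacts [⟨u, rfl⟩, ⟨v, rfl⟩]
  choose C hC using hex
  refine ⟨fun e => if he : e ∈ G.edgeSet then C ⟨e, he⟩ else ∅, fun e he => ?_, ?_⟩
  · obtain ⟨u, v, N, h1, h2, -⟩ := hC ⟨e, he⟩
    exact ⟨u, v, N, h1, by rwa [dif_pos he]⟩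
  · intro e he f hf hef
    rw [dif_pos he, dif_pos hf]
    obtain ⟨_, _, _, -, -, he'⟩ := hC ⟨e, he⟩
    obtain ⟨_, _, _, -, -, hf'⟩ := hC ⟨f, hf⟩
    rintro x ⟨hxe, hxf⟩
    rcases he' hxe with h1 | h1
    · rcases hf' hxf with h2 | h2
      · exact absurd h2 (Set.disjoint_left.1 (hUdisj _ _ fun h => hef (congrArg Subtype.val h)) h1)
      · exact h2
    · exact h1

/-- A graph whose edges split into a polygonal planar drawing with nodes in `M` and a planar
drawing that is generic with respect to `M` is drawn quasiplanar. -/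
theorem exists_quasiplanar_drawing {G : SimpleGraph V} {p : V → Plane}
    (hp : Function.Injective p) {M : Set Plane} (hM : M.Finite) (hpM : range p ⊆ M)
    {c : Sym2 V → Set Plane} {A : Set (Sym2 V)} (hA : IsGenericSystem (range p) p A c)
    (hAM : ∀ e ∈ A, ∃ L a b N, PolyArc L a (c e) b N ∧ N ⊆ M)
    (hB : IsGenericSystem M p (G.edgeSet \ A) c) :
    ∃ Γ : Drawing G, (∀ v, Γ.pos v = p v) ∧ (∀ e, Γ.curve e = c e) ∧ Γ.IsQuasiplanar := by
  have hcross : ∀ e ∈ A, ∀ f ∈ G.edgeSet \ A, ∀ x ∈ c e, x ∈ c f → x ∉ range p →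
      x ∈ spanLines M ∧ CrossProperlyAt (c e) (c f) x ∧ CrossProperlyAt (c f) (c e) x := by
    intro e he f hf x hxe hxf hx
    obtain ⟨L, a, b, N, h1, h2⟩ := hAM e he
    obtain ⟨u, v, N', -, h3⟩ := hB.arc f hf
    exact h1.crossProperlyAt h2 h3.arc h3.nodes h3.avoid hxe hxf
      (by rintro rfl; exact hx ⟨u, rfl⟩) (by rintro rfl; exact hx ⟨v, rfl⟩)
  have hsame : ∀ e f : G.edgeSet, e ≠ f → ((e : Sym2 V) ∈ A ↔ (f : Sym2 V) ∈ A) →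
      c e ∩ c f ⊆ range p := by
    intro e f hef hiff
    have hne : (e : Sym2 V) ≠ f := fun h => hef (Subtype.ext h)
    by_cases he : (e : Sym2 V) ∈ A
    · exact hA.disjoint _ he _ (hiff.1 he) hne
    · exact hB.disjoint _ ⟨e.2, he⟩ _ ⟨f.2, fun hf => he (hiff.2 hf)⟩ hne
  let Γ : Drawing G :=
    { pos := p
      curve := fun e => c e
      pos_injective := hp
      isArc := fun u v h => by
        by_cases he : s(u, v) ∈ A
        · exact hA.isArc he
        · exact hB.isArc ⟨h, he⟩
      mem_of_pos_mem := fun e w hw => by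
        by_cases he : (e : Sym2 V) ∈ A
        · exact hA.mem_of_pos_mem hp Subset.rfl he hw
        · exact hB.mem_of_pos_mem hp hpM ⟨e.2, he⟩ hw
      finite_inter := fun e f hef => by
        by_cases he : (e : Sym2 V) ∈ A <;> by_cases hf : (f : Sym2 V) ∈ A
        · refine finite_empty.subset ?_
          rintro x ⟨⟨hxe, hx⟩, hxf, -⟩
          exact hx (hsame e f hef (by simp [he, hf]) ⟨hxe, hxf⟩)
        · refine (hB.finite_inter_spanLines hM ⟨f.2, hf⟩).subset ?_
          rintro x ⟨⟨hxe, hx⟩, hxf, -⟩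
          exact ⟨hxf, (hcross e he f ⟨f.2, hf⟩ x hxe hxf hx).1⟩
        · refine (hB.finite_inter_spanLines hM ⟨e.2, he⟩).subset ?_
          rintro x ⟨⟨hxe, hx⟩, hxf, -⟩
          exact ⟨hxe, (hcross f hf e ⟨e.2, he⟩ x hxf hxe hx).1⟩
        · refine finite_empty.subset ?_
          rintro x ⟨⟨hxe, hx⟩, hxf, -⟩
          exact hx (hsame e f hef (by simp [he, hf]) ⟨hxe, hxf⟩)
      crossProperly := by
        rintro e f hef x ⟨⟨hxe, hx⟩, hxf, -⟩
        by_cases he : (e : Sym2 V) ∈ A <;> by_cases hf : (f : Sym2 V) ∈ A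
        · exact absurd (hsame e f hef (by simp [he, hf]) ⟨hxe, hxf⟩) hx
        · exact (hcross e he f ⟨f.2, hf⟩ x hxe hxf hx).2.1
        · exact (hcross f hf e ⟨e.2, he⟩ x hxf hxe hx).2.2
        · exact absurd (hsame e f hef (by simp [he, hf]) ⟨hxe, hxf⟩) hx }
  -- The crossing relation is bipartite between A and its complement, hence has no triangle.
  have hdiff : ∀ e f : G.edgeSet, Γ.Cross e f → ¬ ((e : Sym2 V) ∈ A ↔ (f : Sym2 V) ∈ A) := by
    rintro e f ⟨hef, x, ⟨hxe, hx⟩, hxf, -⟩ hiff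
    exact hx (hsame e f hef hiff ⟨hxe, hxf⟩)
  refine ⟨Γ, fun _ => rfl, fun _ => rfl, ?_⟩
  rintro e f g ⟨h1, h2, h3⟩
  have h1 := hdiff e f h1
  have h2 := hdiff f g h2
  have h3 := hdiff e g h3
  tauto

end Drawings

end QuaSEFE

/-! ### Assembly of the three drawings -/

open QuaSEFE

theorem corollary1 {V : Type*} [Finite V] (G₁ T₂ G₃ : SimpleGraph V)
    (hG₁ : QuaSEFE.IsPlanarGraph G₁) (hT₂ : T₂.IsTree) (hG₃ : QuaSEFE.IsPlanarGraph G₃) :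
    ∃ Γ : ∀ i : Fin 3, QuaSEFE.Drawing (![G₁, T₂, G₃] i),
      QuaSEFE.IsQuaSEFE Γ ∧ (Γ 2).IsPlanar := by
  classical
  obtain ⟨p, hp⟩ : ∃ p : V → Plane, Function.Injective p :=
    let ⟨Γ, _⟩ := hG₃
    ⟨Γ.pos, Γ.pos_injective⟩
  obtain ⟨c₃, h₃⟩ := exists_isGenericSystem_of_isPlanarGraph hG₃ hp (Set.finite_range p) le_rfl
  have hnodes : ∀ e : G₃.edgeSet, ∃ N : Set Plane, N.Finite ∧
      ∃ L a b, PolyArc L a (c₃ e) b N := by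
    rintro ⟨e, he⟩
    obtain ⟨u, v, N, -, h⟩ := h₃.arc e he
    exact ⟨N, h.arc.finite_nodes, _, _, _, h.arc⟩
  choose N hNfin hN using hnodes
  -- Fixed after `G₃` is drawn: the other curves must be generic with respect to its bends as well
  -- as the vertices.
  let M : Set Plane := Set.range p ∪ ⋃ e, N e
  have hM : M.Finite := (Set.finite_range p).union (Set.finite_iUnion hNfin)
  have hpM : Set.range p ⊆ M := Set.subset_union_left
  obtain ⟨c₁, h₁⟩ := exists_isGenericSystem_of_isPlanarGraph hG₁ hp hM hpM
  obtain ⟨c₂, hc₂, h₂⟩ := (h₁.mono (S' := (T₂.edgeSet ∩ G₁.edgeSet) \ G₃.edgeSet)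
    fun e he => he.1.2).exists_union hp hM hpM hT₂ (fun e he => he.1.1)
    (D := T₂.edgeSet \ (G₁.edgeSet ∪ G₃.edgeSet)) Set.sdiff_subset
    (Set.disjoint_left.2 fun e he hd => hd.2 (Or.inl he.1.2))
  -- One curve per vertex pair makes the drawings agree on shared edges; `c₂` equals `c₁` on the
  -- edges of `T₂` and `G₁` outside `G₃`.
  let c : Sym2 V → Set Plane := fun e =>
    if e ∈ G₃.edgeSet then c₃ e else if e ∈ T₂.edgeSet then c₂ e else c₁ e
  have hA : IsGenericSystem (Set.range p) p G₃.edgeSet c := h₃.congr fun e he => if_pos he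
  have hAM : ∀ e ∈ G₃.edgeSet, ∃ L a b N, PolyArc L a (c e) b N ∧ N ⊆ M := by
    intro e he
    obtain ⟨L, a, b, h⟩ := hN ⟨e, he⟩
    have hce : c e = c₃ e := if_pos he
    exact ⟨L, a, b, N ⟨e, he⟩, hce ▸ h,
      (Set.subset_iUnion N ⟨e, he⟩).trans Set.subset_union_right⟩
  have hB₁ : IsGenericSystem M p (G₁.edgeSet \ G₃.edgeSet) c := by
    refine (h₁.mono Set.sdiff_subset).congr fun e he => ?_
    simp only [c, if_neg he.2]
    split_ifs with h
    · exact hc₂ e ⟨⟨h, he.1⟩, he.2⟩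
    · rfl
  have hB₂ : IsGenericSystem M p (T₂.edgeSet \ G₃.edgeSet) c := by
    refine (h₂.mono fun e he => ?_).congr fun e he => ?_
    · by_cases h : e ∈ G₁.edgeSet
      · exact Or.inl ⟨⟨he.1, h⟩, he.2⟩
      · exact Or.inr ⟨he.1, fun h' => h'.elim h he.2⟩
    · simp only [c, if_neg he.2, if_pos he.1]
  have hB : ∀ i : Fin 3, IsGenericSystem M p ((![G₁, T₂, G₃] i).edgeSet \ G₃.edgeSet) c := by
    intro i
    fin_cases i
    · exact hB₁
    · exact hB₂
    -- For `G₃` itself no edge remains outside A.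
    · exact hB₁.mono fun e he => absurd he.1 he.2
  choose Γ hpos hcurve hquasi using fun i => exists_quasiplanar_drawing hp hM hpM hA hAM (hB i)
  refine ⟨Γ, ⟨hquasi, fun i j v => by rw [hpos, hpos], fun i j e hi hj => by
    rw [hcurve, hcurve]⟩, ?_⟩
  rintro e f ⟨hef, x, ⟨hxe, hx⟩, hxf, -⟩
  rw [hcurve] at hxe hxf
  obtain ⟨w, rfl⟩ := hA.disjoint e e.2 f f.2 (fun h => hef (Subtype.ext h)) ⟨hxe, hxf⟩
  exact hx ⟨w, hpos 2 w⟩
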